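/- For a permutation $\pi$ of $[n]$ let $\mathcal Z(\pi)=\{x\in\mathbb R^n: x_{\pi(1)}\ge\cdots\ge x_{\pi(n)}\}$ be the cone of the vectors sorted by $\pi$. A set $\mathcal X\subseteq\mathbb R^n$ is called comonotone with permutation mapping $\Psi:\Pi_n\to\Pi_n$ (where $\Pi_n$ is the set of permutations of $[n]$) if for every $\pi\in\Pi_n$ and every $v\in\mathcal Z(\pi)$: whenever $\max_{x\in\mathcal X}v^\top x$ is attained, it has an optimal solution in $\mathcal Z(\Psi(\pi))$. Fix an integer $r\ge 1$. For $n\ge r$, let $A\in\mathbb R^{r\times n}$ have full row rank, let $f:\mathbb R^r\to\mathbb R$ be convex, and let $\mathcal X\subseteq\mathbb R^n$ be comonotone with permutation mapping $\Psi$. Consider the problem $$\max_{x\in\mathcal X} f(Ax),\qquad (\ast)$$ and assume that it has an optimal solution. Write $\operatorname{supp}(x)=\{i: x_i\ne0\}$. Constants in $\mathcal O(\cdot)$ depend only on $r$. (i) There is a collection of $\mathcal O(n^{2r})$ subsets of $[n]$, depending only on $A$ and $\Psi$ (not on $f$ or on $\mathcal X$ otherwise), at least one of which is the support of an optimal solution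 of $(\ast)$. (ii) Suppose that there is an oracle which for every $S\subseteq[n]$ solves $\max\{f(Ax):x\in\mathcal X,\ \operatorname{supp}(x)=S\}$ in time $\mathsf T_1\ge 1$, that is, it returns an optimal solution together with the optimal value if an optimal solution exists and reports that none exists otherwise, and that there is an oracle which for every $\pi\in\Pi_n$ returns $\Psi(\pi)$ in time $\mathsf T_2\ge1$. Then there is an algorithm, the same for all instances of rank $r$, which given $n$ and $A$ and using the two oracles computes an optimal solution of $(\ast)$ in time $\mathcal O(n^{2r-2}\cdot\mathsf T_2+n^{2r}\cdot\mathsf T_1)$; in particular it runs in polynomial time if $\mathsf T_1$ and $\mathsf T_2$ are polynomial. Time is counted on a real random access machine: each arithmetic operation on, comparison of, or memory access to real numbers or integers costs one step, and the oracle calls cost $\mathsf T_1$ and $\mathsf T_2$ steps. -/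

import Mathlib

open Matrix

/-! ## Convex maximization over comonotone sets -/

/-- `x` is an optimal solution of the problem of maximizing `F` over `X`. -/
def IsOptimal {n : ℕ} (F : (Fin n → ℝ) → ℝ) (X : Set (Fin n → ℝ)) (x : Fin n → ℝ) : Prop :=
  x ∈ X ∧ ∀ y ∈ X, F y ≤ F x

/-- The cone of the vectors sorted by `π`, i.e. `x (π 0) ≥ x (π 1) ≥ ⋯ ≥ x (π (n - 1))`. -/
def sortedCone {n : ℕ} (π : Equiv.Perm (Fin n)) : Set (Fin n → ℝ) :=
  {x | ∀ i j : Fin n, i ≤ j → x (π j) ≤ x (π i)}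

/-- `X` is comonotone with permutation mapping `Ψ`: for every permutation `π` and every cost vector
`v` sorted by `π`, if the linear problem `max {vᵀx : x ∈ X}` attains its optimum, then it has an
optimal solution sorted by `Ψ π`. -/
def ComonotoneVia {n : ℕ} (Ψ : Equiv.Perm (Fin n) → Equiv.Perm (Fin n))
    (X : Set (Fin n → ℝ)) : Prop :=
  ∀ (π : Equiv.Perm (Fin n)) (v : Fin n → ℝ), v ∈ sortedCone π →
    (∃ x, IsOptimal (fun y => v ⬝ᵥ y) X x) →
      ∃ x ∈ sortedCone (Ψ π), IsOptimal (fun y => v ⬝ᵥ y) X x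

/-- The fixed-support feasible set `{x ∈ X : supp x = S}`. -/
def fixedSupport {n : ℕ} (X : Set (Fin n → ℝ)) (S : Finset (Fin n)) : Set (Fin n → ℝ) :=
  {x | x ∈ X ∧ Function.support x = (S : Set (Fin n))}

/-- `ans` solves all fixed-support problems `max {F x : x ∈ X, supp x = S}`: it returns an optimal
solution together with the optimal value if there is an optimal solution, and reports (by `none`)
that there is no optimal solution otherwise. -/
def SolvesFixedSupport {n : ℕ} (F : (Fin n → ℝ) → ℝ) (X : Set (Fin n → ℝ))
    (ans : Finset (Fin n) → Option ((Fin n → ℝ) × ℝ)) : Prop :=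
  ∀ S : Finset (Fin n),
    (∀ x z, ans S = some (x, z) → IsOptimal F (fixedSupport X S) x ∧ z = F x) ∧
    (ans S = none → ¬ ∃ x, IsOptimal F (fixedSupport X S) x)

/-! ## A real random access machine with two oracles

Programs of a structured real RAM.  The memory consists of arrays of natural numbers and arrays of
real numbers, with indirect addressing.  Natural numbers can be added, subtracted (truncated at
`0`) and compared; real numbers can be added, subtracted, multiplied, divided (a quotient by `0`
is `0`) and compared.  Each of these operations and each memory access costs one step. -/

namespace RealRAM

/-- Memory: `nat a i` and `real a i` are the `i`-th entries of the `a`-th array of natural numbers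
and of the `a`-th array of real numbers. -/
structure Store where
  nat : ℕ → ℕ → ℕ
  real : ℕ → ℕ → ℝ

/-- Integer expressions; `get a i` is the entry of array `a` at the index computed by `i`. -/
inductive NExp where
  | const (k : ℕ)
  | get (a : ℕ) (i : NExp)
  | add (e₁ e₂ : NExp)
  | sub (e₁ e₂ : NExp)

/-- Real expressions.  The only constants available to a program are integers. -/
inductive RExp where
  | const (k : ℤ)
  | get (a : ℕ) (i : NExp)
  | add (e₁ e₂ : RExp)
  | sub (e₁ e₂ : RExp)
  | mul (e₁ e₂ : RExp)
  | div (e₁ e₂ : RExp)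

/-- Tests: comparisons of integers and of reals, and their Boolean combinations. -/
inductive BExp where
  | natLe (e₁ e₂ : NExp)
  | realLe (e₁ e₂ : RExp)
  | neg (b : BExp)
  | conj (b₁ b₂ : BExp)

/-- Programs.  Array names occurring in a program are fixed, indices are computed.
`askPerm src dst` queries the permutation mapping at the permutation stored in the integer array
`src` and stores the answer in the integer array `dst`.
`askSupp src dst val flag` queries the fixed-support oracle at the set whose indicator is stored in
the integer array `src`.  If there is an answer, the solution is stored in the real array `dst`, its
objective value in entry `0` of the real array `val`, and entry `0` of the integer array `flag`
becomes `1`; otherwise only that last entry changes, to `0`. -/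
inductive Program where
  | skip
  | setNat (a : ℕ) (i : NExp) (e : NExp)
  | setReal (a : ℕ) (i : NExp) (e : RExp)
  | seq (p q : Program)
  | cond (b : BExp) (p q : Program)
  | loop (b : BExp) (p : Program)
  | askPerm (src dst : ℕ)
  | askSupp (src dst val flag : ℕ)

/-- The value of an integer expression. -/
def NExp.eval (s : Store) : NExp → ℕ
  | const k => k
  | get a i => s.nat a (i.eval s)
  | add e₁ e₂ => e₁.eval s + e₂.eval s
  | sub e₁ e₂ => e₁.eval s - e₂.eval s

/-- The number of steps for evaluating an integer expression. -/
def NExp.cost : NExp → ℕ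
  | const _ => 1
  | get _ i => i.cost + 1
  | add e₁ e₂ => e₁.cost + e₂.cost + 1
  | sub e₁ e₂ => e₁.cost + e₂.cost + 1

/-- The value of a real expression. -/
noncomputable def RExp.eval (s : Store) : RExp → ℝ
  | const k => (k : ℝ)
  | get a i => s.real a (i.eval s)
  | add e₁ e₂ => e₁.eval s + e₂.eval s
  | sub e₁ e₂ => e₁.eval s - e₂.eval s
  | mul e₁ e₂ => e₁.eval s * e₂.eval s
  | div e₁ e₂ => e₁.eval s / e₂.eval s

/-- The number of steps for evaluating a real expression. -/
def RExp.cost : RExp → ℕ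
  | const _ => 1
  | get _ i => i.cost + 1
  | add e₁ e₂ => e₁.cost + e₂.cost + 1
  | sub e₁ e₂ => e₁.cost + e₂.cost + 1
  | mul e₁ e₂ => e₁.cost + e₂.cost + 1
  | div e₁ e₂ => e₁.cost + e₂.cost + 1

/-- The truth value of a test. -/
def BExp.holds (s : Store) : BExp → Prop
  | natLe e₁ e₂ => e₁.eval s ≤ e₂.eval s
  | realLe e₁ e₂ => e₁.eval s ≤ e₂.eval s
  | neg b => ¬ b.holds s
  | conj b₁ b₂ => b₁.holds s ∧ b₂.holds s

/-- The number of steps for evaluating a test. -/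
def BExp.cost : BExp → ℕ
  | natLe e₁ e₂ => e₁.cost + e₂.cost + 1
  | realLe e₁ e₂ => e₁.cost + e₂.cost + 1
  | neg b => b.cost + 1
  | conj b₁ b₂ => b₁.cost + b₂.cost + 1

/-- Write `k` into entry `i` of the integer array `a`. -/
def Store.writeNat (s : Store) (a i k : ℕ) : Store where
  nat := fun b j => if b = a ∧ j = i then k else s.nat b j
  real := s.real

/-- Write `z` into entry `i` of the real array `a`. -/
def Store.writeReal (s : Store) (a i : ℕ) (z : ℝ) : Store where
  nat := s.nat
  real := fun b j => if b = a ∧ j = i then z else s.real b j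

/-- Write `π 0, …, π (n - 1)` into the entries `0, …, n - 1` of the integer array `a`. -/
def Store.writePerm {n : ℕ} (s : Store) (a : ℕ) (π : Equiv.Perm (Fin n)) : Store where
  nat := fun b j => if h : b = a ∧ j < n then (π ⟨j, h.2⟩ : ℕ) else s.nat b j
  real := s.real

/-- Write `x 0, …, x (n - 1)` into the entries `0, …, n - 1` of the real array `a`. -/
def Store.writeVec {n : ℕ} (s : Store) (a : ℕ) (x : Fin n → ℝ) : Store where
  nat := s.nat
  real := fun b j => if h : b = a ∧ j < n then x ⟨j, h.2⟩ else s.real b j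

/-- The entries `0, …, n - 1` of the real array `a`, as a vector. -/
def Store.readVec (s : Store) (a n : ℕ) : Fin n → ℝ := fun j => s.real a j

/-- The set whose indicator is stored in the entries `0, …, n - 1` of the integer array `a`. -/
def Store.readSet (s : Store) (a n : ℕ) : Finset (Fin n) :=
  Finset.univ.filter fun j => s.nat a j ≠ 0

/-- The integer array `a` contains the permutation `π` in its entries `0, …, n - 1`. -/
def Store.HoldsPerm {n : ℕ} (s : Store) (a : ℕ) (π : Equiv.Perm (Fin n)) : Prop :=
  ∀ j : Fin n, s.nat a j = π j

/-- The oracles: the permutation mapping, each query of which costs `permTime` steps, and the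
solver of the fixed-support problems, each query of which costs `suppTime` steps. -/
structure Oracles (n : ℕ) where
  perm : Equiv.Perm (Fin n) → Equiv.Perm (Fin n)
  permTime : ℕ
  supp : Finset (Fin n) → Option ((Fin n → ℝ) × ℝ)
  suppTime : ℕ

/-- The effect on the memory of an answer of the fixed-support oracle. -/
def Store.receive {n : ℕ} (s : Store) (dst val flag : ℕ) :
    Option ((Fin n → ℝ) × ℝ) → Store
  | none => s.writeNat flag 0 0
  | some (x, z) => ((s.writeVec dst x).writeReal val 0 z).writeNat flag 0 1

/-- `Exec O p s t s'`: with the oracles `O`, program `p` started on memory `s` halts after exactly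
`t` steps with memory `s'`.  A query of the permutation mapping at an array that is not a
permutation has no successor: such a run does not halt. -/
inductive Exec {n : ℕ} (O : Oracles n) : Program → Store → ℕ → Store → Prop
  | skip (s : Store) : Exec O .skip s 1 s
  | setNat (a : ℕ) (i e : NExp) (s : Store) :
      Exec O (.setNat a i e) s (i.cost + e.cost + 1) (s.writeNat a (i.eval s) (e.eval s))
  | setReal (a : ℕ) (i : NExp) (e : RExp) (s : Store) :
      Exec O (.setReal a i e) s (i.cost + e.cost + 1) (s.writeReal a (i.eval s) (e.eval s))
  | seq {p q : Program} {s s₁ s₂ : Store} {t₁ t₂ : ℕ} :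
      Exec O p s t₁ s₁ → Exec O q s₁ t₂ s₂ → Exec O (.seq p q) s (t₁ + t₂) s₂
  | condTrue {b : BExp} {p q : Program} {s s₁ : Store} {t : ℕ} :
      b.holds s → Exec O p s t s₁ → Exec O (.cond b p q) s (b.cost + t) s₁
  | condFalse {b : BExp} {p q : Program} {s s₁ : Store} {t : ℕ} :
      ¬ b.holds s → Exec O q s t s₁ → Exec O (.cond b p q) s (b.cost + t) s₁
  | loopDone {b : BExp} {p : Program} {s : Store} :
      ¬ b.holds s → Exec O (.loop b p) s b.cost s
  | loopStep {b : BExp} {p : Program} {s s₁ s₂ : Store} {t₁ t₂ : ℕ} :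
      b.holds s → Exec O p s t₁ s₁ → Exec O (.loop b p) s₁ t₂ s₂ →
      Exec O (.loop b p) s (b.cost + t₁ + t₂) s₂
  | askPerm {src dst : ℕ} {s : Store} {π : Equiv.Perm (Fin n)} :
      s.HoldsPerm src π →
      Exec O (.askPerm src dst) s O.permTime (s.writePerm dst (O.perm π))
  | askSupp (src dst val flag : ℕ) (s : Store) :
      Exec O (.askSupp src dst val flag) s O.suppTime
        (s.receive dst val flag (O.supp (s.readSet src n)))

/-- Runs are deterministic: running time and final memory are determined by the program, the
initial memory and the oracles. -/
theorem Exec.deterministic {n : ℕ} {O : Oracles n} {p : Program} {s s₁ s₂ : Store} {t₁ t₂ : ℕ}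
    (h₁ : Exec O p s t₁ s₁) (h₂ : Exec O p s t₂ s₂) : t₁ = t₂ ∧ s₁ = s₂ := by
  induction h₁ generalizing t₂ s₂ with
  | skip | setNat | setReal | askSupp => cases h₂; exact ⟨rfl, rfl⟩
  | seq _ _ ih₁ ih₂ =>
    cases h₂ with
    | seq k₁ k₂ =>
      obtain ⟨rfl, rfl⟩ := ih₁ k₁
      obtain ⟨rfl, rfl⟩ := ih₂ k₂
      exact ⟨rfl, rfl⟩
  | condTrue hb _ ih =>
    cases h₂ with
    | condTrue _ k => obtain ⟨rfl, rfl⟩ := ih k; exact ⟨rfl, rfl⟩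
    | condFalse hb' _ => exact absurd hb hb'
  | condFalse hb _ ih =>
    cases h₂ with
    | condTrue hb' _ => exact absurd hb' hb
    | condFalse _ k => obtain ⟨rfl, rfl⟩ := ih k; exact ⟨rfl, rfl⟩
  | loopDone hb =>
    cases h₂ with
    | loopDone => exact ⟨rfl, rfl⟩
    | loopStep hb' => exact absurd hb' hb
  | loopStep hb _ _ ih₁ ih₂ =>
    cases h₂ with
    | loopDone hb' => exact absurd hb hb'
    | loopStep _ k₁ k₂ =>
      obtain ⟨rfl, rfl⟩ := ih₁ k₁
      obtain ⟨rfl, rfl⟩ := ih₂ k₂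
      exact ⟨rfl, rfl⟩
  | askPerm hπ =>
    cases h₂ with
    | askPerm hρ =>
      have : ∀ j, _ := fun j => Fin.ext ((hπ j).symm.trans (hρ j))
      rw [Equiv.ext this]
      exact ⟨rfl, rfl⟩

/-- The initial memory for the input `A` (with `r` rows and `n` columns): entry `0` of the integer
array `0` is `n`, row `i` of `A` is stored in the real array `i`, and everything else is `0`. -/
def input {r n : ℕ} (A : Matrix (Fin r) (Fin n) ℝ) : Store where
  nat := fun a j => if a = 0 ∧ j = 0 then n else 0
  real := fun a j => if h : a < r ∧ j < n then A ⟨a, h.1⟩ ⟨j, h.2⟩ else 0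

end RealRAM

/-! ## Lexicographic orders and sorting permutations -/

/-! Let x₀ be optimal and g a subgradient of f at A x₀. The subgradient inequality shows that x₀
maximizes the linear function gᵀA over X, and that every maximizer of gᵀA over X is again optimal
for f(Ax). Hence, for any permutation π sorting gᵀA, comonotonicity gives an optimal solution sorted
by Ψ(π) (`exists_candidate_isOptimal`). In a sorted vector the positive entries come first and the
negative entries last, so its support is one of (n + 1)² sets determined by Ψ(π)
(`exists_support_eq_endsSet`). It remains to find O(n^(2r-2)) permutations, computable from A, such
that every vector of the row space W is sorted by one of them.

The hyperplanes w x = w y cut W into cells, and a vector in the closure of a cell is sorted by the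
order of the cell. Cells are found by descending to facets. If v is generic in its cell, some pair
(i, j) and some v' generic in W ∩ {w i = w j} span a facet of that cell (`exists_facet`). The order
of v is the order of v' with ties broken by any b in W scaled to b i - b j = 1, because on W each
difference that vanishes at v' is a fixed multiple of w i - w j. Choosing b among the spanning rows
and eliminating it from the others leaves one row fewer, now spanning the hyperplane; with a single
row only the two signs remain. The order is thus lexicographic in a list of keys, the last row first
and then the pivots from the latest to the earliest (`exists_candidate`). Each elimination has at
most r choices of b and n² of (i, j), and there are r - 1 of them, which gives the count
(`exists_finset_candidates`).

The algorithm unrolls this recursion, whose depth depends only on r, into nested loops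
(`enumerate`). At each leaf it sorts by the keys, asks for Ψ once and tries all (n + 1)² supports,
at cost O(n² T₁ + T₂). Integer array 0 holds n, arrays 1 and 2 hold π and Ψ(π), 3 the queried set, 4
and 5 the flags of the trial and of the incumbent, 6 to 8 counters. Real arrays below r hold A, r
and r + 2 the incumbent and its value, r + 1 and r + 3 the trial; higher names are working space.
Correctness is expressed by a threshold z unknown to the program: a path that hits z makes the
incumbent reach z. -/

/-- `x` comes before `y` when the entries are sorted decreasingly, lexicographically by the given
key vectors, with remaining ties broken by the index. -/
def LexBefore {n : ℕ} : List (Fin n → ℝ) → Fin n → Fin n → Prop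
  | [], x, y => x < y
  | a :: ks, x, y => a y ≤ a x ∧ (a y < a x ∨ LexBefore ks x y)

theorem LexBefore.irrefl {n : ℕ} (ks : List (Fin n → ℝ)) (x : Fin n) : ¬ LexBefore ks x x := by
  induction ks with
  | nil => simp [LexBefore]
  | cons a ks ih => simp [LexBefore, ih]

theorem LexBefore.trans {n : ℕ} {ks : List (Fin n → ℝ)} {x y z : Fin n}
    (h₁ : LexBefore ks x y) (h₂ : LexBefore ks y z) : LexBefore ks x z := by
  induction ks with
  | nil => exact lt_trans h₁ h₂
  | cons a ks ih =>
    obtain ⟨h1, h1'⟩ := h₁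
    obtain ⟨h2, h2'⟩ := h₂
    refine ⟨h2.trans h1, ?_⟩
    rcases h1' with h1' | h1'
    · exact Or.inl (h2.trans_lt h1')
    · rcases h2' with h2' | h2'
      · exact Or.inl (h2'.trans_le h1)
      · exact Or.inr (ih h1' h2')

theorem LexBefore.trichotomous {n : ℕ} (ks : List (Fin n → ℝ)) (x y : Fin n) :
    LexBefore ks x y ∨ x = y ∨ LexBefore ks y x := by
  induction ks with
  | nil => exact lt_trichotomy x y
  | cons a ks ih =>
    rcases lt_trichotomy (a x) (a y) with h | h | h
    · exact Or.inr (Or.inr ⟨h.le, Or.inl h⟩)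
    · rcases ih with h' | h' | h'
      · exact Or.inl ⟨h.ge, Or.inr h'⟩
      · exact Or.inr (Or.inl h')
      · exact Or.inr (Or.inr ⟨h.le, Or.inr h'⟩)
    · exact Or.inl ⟨h.le, Or.inl h⟩

open Classical in
/-- The number of entries that come before `x`. -/
noncomputable def lexRank {n : ℕ} (ks : List (Fin n → ℝ)) (x : Fin n) : ℕ :=
  (Finset.univ.filter fun y => LexBefore ks y x).card

theorem lexRank_lt {n : ℕ} (ks : List (Fin n → ℝ)) (x : Fin n) : lexRank ks x < n := by
  classical
  have : (Finset.univ.filter fun y => LexBefore ks y x) ⊂ Finset.univ := by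
    rw [Finset.ssubset_univ_iff]
    intro h
    have := Finset.mem_univ x
    rw [← h] at this
    exact LexBefore.irrefl ks x (by simpa using this)
  simpa [lexRank] using Finset.card_lt_card this

theorem lexRank_lt_lexRank {n : ℕ} {ks : List (Fin n → ℝ)} {x y : Fin n} (h : LexBefore ks x y) :
    lexRank ks x < lexRank ks y := by
  classical
  apply Finset.card_lt_card
  rw [Finset.ssubset_iff_of_subset]
  · exact ⟨x, by simpa using h, by simpa using LexBefore.irrefl ks x⟩
  · intro z hz
    simp only [Finset.mem_filter, Finset.mem_univ, true_and] at hz ⊢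
    exact hz.trans h

/-- The permutation that sorts the entries decreasingly by the given keys. -/
noncomputable def lexPerm {n : ℕ} (ks : List (Fin n → ℝ)) : Equiv.Perm (Fin n) :=
  (Equiv.ofBijective (fun x => (⟨lexRank ks x, lexRank_lt ks x⟩ : Fin n))
    (Finite.injective_iff_bijective.mp fun x y hxy => by
      have hxy : lexRank ks x = lexRank ks y := congrArg Fin.val hxy
      rcases LexBefore.trichotomous ks x y with h | h | h
      · exact absurd hxy (lexRank_lt_lexRank h).ne
      · exact h
      · exact absurd hxy (lexRank_lt_lexRank h).ne')).symm

theorem lexPerm_lexRank {n : ℕ} (ks : List (Fin n → ℝ)) (x : Fin n) :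
    lexPerm ks ⟨lexRank ks x, lexRank_lt ks x⟩ = x :=
  Equiv.ofBijective_symm_apply_apply _ _ x

theorem lexRank_lexPerm {n : ℕ} (ks : List (Fin n → ℝ)) (i : Fin n) :
    lexRank ks (lexPerm ks i) = i :=
  congrArg Fin.val (Equiv.ofBijective_apply_symm_apply
    (fun x => (⟨lexRank ks x, lexRank_lt ks x⟩ : Fin n)) _ i)

/-- Ties of `u` may be broken arbitrarily, so the order of a cell also serves the vectors in its
closure. -/
theorem mem_sortedCone_lexPerm {n : ℕ} {ks : List (Fin n → ℝ)} {u : Fin n → ℝ}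
    (h : ∀ x y, u y < u x → LexBefore ks x y) : u ∈ sortedCone (lexPerm ks) := by
  intro i j hij
  by_contra! hlt
  have := lexRank_lt_lexRank (h _ _ hlt)
  rw [lexRank_lexPerm, lexRank_lexPerm] at this
  exact absurd hij (not_le.mpr (by exact_mod_cast this))

/-! ## Cells of the arrangement of the hyperplanes of vectors with two equal entries -/

/-- `v` has no ties except those that all vectors of `W` have. -/
def IsGenericIn {n : ℕ} (W : Submodule ℝ (Fin n → ℝ)) (v : Fin n → ℝ) : Prop :=
  ∀ x y, v x = v y → ∀ w ∈ W, w x = w y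

/-- The linear functional `w ↦ c * (w k - w l) - d * (w x - w y)`. -/
noncomputable def gapDual {n : ℕ} (c d : ℝ) (x y k l : Fin n) : Module.Dual ℝ (Fin n → ℝ) :=
  let e := fun z : Fin n => LinearMap.proj (R := ℝ) (φ := fun _ : Fin n => ℝ) z
  c • (e k - e l) - d • (e x - e y)

theorem gapDual_apply {n : ℕ} (c d : ℝ) (x y k l : Fin n) (w : Fin n → ℝ) :
    gapDual c d x y k l w = c * (w k - w l) - d * (w x - w y) := by
  simp [gapDual]

/-- A submodule has an element outside the kernels of finitely many functionals, except those that
vanish on the submodule. -/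
theorem exists_mem_forall_dual_eq_zero {n : ℕ} (W : Submodule ℝ (Fin n → ℝ)) {ι : Type*} [Finite ι]
    (φ : ι → Module.Dual ℝ (Fin n → ℝ)) :
    ∃ u ∈ W, ∀ i, φ i u = 0 → ∀ w ∈ W, φ i w = 0 := by
  let J := {i : ι // ∃ w ∈ W, φ i w ≠ 0}
  obtain ⟨u, hu, h⟩ := Module.Dual.exists_forall_mem_ne_zero_of_forall_exists W
    (fun j : J => φ j.1) (fun j => j.2)
  refine ⟨u, hu, fun i hi w hw => ?_⟩
  by_contra hne
  exact h ⟨i, w, hw, hne⟩ hi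

/-- Perturbation: add a generic `w` to a large multiple of `u`. The multiple preserves the strict
inequalities of `u`, and where `u` is tied, `w` has only the unavoidable ties. -/
theorem exists_isGenericIn {n : ℕ} (W : Submodule ℝ (Fin n → ℝ)) {u : Fin n → ℝ} (hu : u ∈ W) :
    ∃ v ∈ W, IsGenericIn W v ∧ ∀ x y, u y < u x → v y < v x := by
  obtain ⟨w, hw, hg⟩ := exists_mem_forall_dual_eq_zero W
    (fun p : Fin n × Fin n => gapDual 1 0 p.1 p.1 p.1 p.2)
  simp only [gapDual_apply, one_mul, zero_mul, sub_zero, sub_eq_zero, Prod.forall] at hg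
  have : ∀ x y, ∀ᶠ c : ℝ in Filter.atTop, u y < u x → c * u y + w y < c * u x + w x := by
    intro x y
    filter_upwards [Filter.eventually_gt_atTop ((w y - w x) / (u x - u y))] with c hc h
    rw [div_lt_iff₀ (by linarith)] at hc
    linarith
  obtain ⟨c, hc⟩ := (Filter.eventually_all.mpr fun x => Filter.eventually_all.mpr (this x)).exists
  refine ⟨c • u + w, W.add_mem (W.smul_mem c hu) hw, fun x y hxy => ?_, by simpa using hc⟩
  simp only [Pi.add_apply, Pi.smul_apply, smul_eq_mul] at hxy
  rcases lt_trichotomy (u x) (u y) with h | h | h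
  · exact absurd hxy (hc y x h).ne
  · rw [h, add_right_inj] at hxy
    exact hg x y hxy
  · exact absurd hxy (hc x y h).ne'

/-- A facet of the cell of a generic vector `v`: some generic vector `v'` of a hyperplane
`{w ∈ W | w i = w j}` lies in the closure of the cell of `v`. -/
theorem exists_facet {n : ℕ} {W : Submodule ℝ (Fin n → ℝ)} {v : Fin n → ℝ} (hv : v ∈ W)
    (hg : IsGenericIn W v) (hne : ∃ x y, v x ≠ v y) :
    ∃ i j, v j < v i ∧ ∃ v' ∈ W, v' i = v' j ∧ (∀ x y, v' y < v' x → v y < v x) ∧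
      ∀ x y, v' x = v' y → ∀ w ∈ W, (w x - w y) * (v i - v j) = (v x - v y) * (w i - w j) := by
  classical
  -- A direction `u` for which two gap ratios (u x - u y) / (v x - v y) coincide only if the two
  -- gaps are proportional on all of `W`.
  obtain ⟨u, hu, hφ⟩ := exists_mem_forall_dual_eq_zero W
    (fun p : (Fin n × Fin n) × (Fin n × Fin n) =>
      gapDual (v p.1.1 - v p.1.2) (v p.2.1 - v p.2.2) p.1.1 p.1.2 p.2.1 p.2.2)
  simp only [gapDual_apply, Prod.forall] at hφ
  let P : Finset (Fin n × Fin n) := Finset.univ.filter fun p => v p.2 < v p.1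
  have hP : P.Nonempty := by
    obtain ⟨x, y, hxy⟩ := hne
    rcases lt_or_gt_of_ne hxy with h | h
    · exact ⟨(y, x), by simpa [P] using h⟩
    · exact ⟨(x, y), by simpa [P] using h⟩
  obtain ⟨⟨i, j⟩, hij, hmax⟩ := P.exists_max_image
    (fun p => (u p.1 - u p.2) / (v p.1 - v p.2)) hP
  simp only [P, Finset.mem_filter, Finset.mem_univ, true_and, Prod.forall] at hij hmax
  set c := (u i - u j) / (v i - v j) with hc
  have hcij : u i - u j = c * (v i - v j) := by
    rw [hc, div_mul_cancel₀]
    exact (sub_pos.mpr hij).ne'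
  have key : ∀ x y, v y < v x → u x - u y ≤ c * (v x - v y) := fun x y h =>
    (div_le_iff₀ (sub_pos.mpr h)).mp (hmax x y h)
  -- Since `c` is the largest gap ratio, no gap of `c • v - u` has the sign opposite to that of `v`,
  -- and the maximizing pair `(i, j)` becomes tied: the ray leaves the cell through this facet.
  refine ⟨i, j, hij, c • v - u, W.sub_mem (W.smul_mem c hv) hu, ?_, ?_, ?_⟩
  · simp only [Pi.sub_apply, Pi.smul_apply, smul_eq_mul]
    linarith
  · intro x y hxy
    simp only [Pi.sub_apply, Pi.smul_apply, smul_eq_mul] at hxy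
    rcases lt_trichotomy (v x) (v y) with h | h | h
    · linarith [key y x h]
    · rw [h, hg x y h u hu] at hxy
      exact absurd hxy (lt_irrefl _)
    · exact h
  · intro x y hxy w hw
    simp only [Pi.sub_apply, Pi.smul_apply, smul_eq_mul] at hxy
    have hcxy : u x - u y = c * (v x - v y) := by linarith
    have := hφ i j x y (by rw [hcij, hcxy]; ring) w hw
    linarith

/-! ## Elimination paths -/

/-- The pivot vector `b`, scaled such that its entries `i` and `j` differ by `1`. -/
noncomputable def pivot {n : ℕ} (b : Fin n → ℝ) (i j : Fin n) : Fin n → ℝ :=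
  fun x => b x / (b i - b j)

/-- Subtract the multiple of the pivot from `a` that makes the entries `i` and `j` equal. -/
noncomputable def elim {n : ℕ} (b : Fin n → ℝ) (i j : Fin n) (a : Fin n → ℝ) : Fin n → ℝ :=
  fun x => a x - (a i - a j) * pivot b i j x

/-- `Candidate rows ks K`: starting with the accumulated keys `ks`, successive eliminations applied
to `rows` can lead to the list of keys `K`. -/
inductive Candidate {n : ℕ} :
    List (Fin n → ℝ) → List (Fin n → ℝ) → List (Fin n → ℝ) → Prop
  | base (a : Fin n → ℝ) (ks : List (Fin n → ℝ)) : Candidate [a] ks (a :: ks)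
  | baseNeg (a : Fin n → ℝ) (ks : List (Fin n → ℝ)) : Candidate [a] ks ((-a) :: ks)
  | step {rows ks K : List (Fin n → ℝ)} {k : ℕ} {b : Fin n → ℝ} (i j : Fin n) :
      2 ≤ rows.length → rows[k]? = some b →
      Candidate ((rows.eraseIdx k).map (elim b i j)) (pivot b i j :: ks) K → Candidate rows ks K

theorem Candidate.exists_step {n : ℕ} {rows ks K : List (Fin n → ℝ)} (h : Candidate rows ks K)
    (h2 : 2 ≤ rows.length) : ∃ k i j b, rows[k]? = some b ∧
      Candidate ((rows.eraseIdx k).map (elim b i j)) (pivot b i j :: ks) K := by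
  cases h with
  | base => simp at h2
  | baseNeg => simp at h2
  | step i j _ hb hK => exact ⟨_, i, j, _, hb, hK⟩

theorem mem_iff_eq_or_mem_eraseIdx {α : Type*} {l : List α} {k : ℕ} {b : α} (h : l[k]? = some b)
    (x : α) : x ∈ l ↔ x = b ∨ x ∈ l.eraseIdx k := by
  obtain ⟨hk, rfl⟩ := List.getElem?_eq_some_iff.mp h
  rw [← (List.getElem_cons_eraseIdx_perm hk).mem_iff, List.mem_cons]

theorem span_elim_le {n : ℕ} {rows : List (Fin n → ℝ)} {k : ℕ} {b : Fin n → ℝ}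
    (h : rows[k]? = some b) {i j : Fin n} :
    Submodule.span ℝ {x | x ∈ (rows.eraseIdx k).map (elim b i j)} ≤
      Submodule.span ℝ {x | x ∈ rows} := by
  rw [Submodule.span_le]
  intro x hx
  obtain ⟨a, ha, rfl⟩ := List.mem_map.mp hx
  have e : elim b i j a = a - ((a i - a j) / (b i - b j)) • b := by
    ext x
    simp only [elim, pivot, Pi.sub_apply, Pi.smul_apply, smul_eq_mul]
    ring
  rw [e]
  exact Submodule.sub_mem _
    (Submodule.subset_span ((mem_iff_eq_or_mem_eraseIdx h a).mpr (Or.inr ha)))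
    (Submodule.smul_mem _ _ (Submodule.subset_span ((mem_iff_eq_or_mem_eraseIdx h b).mpr
      (Or.inl rfl))))

theorem apply_eq_of_mem_span_elim {n : ℕ} {l : List (Fin n → ℝ)} {b : Fin n → ℝ} {i j : Fin n}
    (hb : b i ≠ b j) {w : Fin n → ℝ}
    (hw : w ∈ Submodule.span ℝ {x | x ∈ l.map (elim b i j)}) : w i = w j := by
  have hb' := sub_ne_zero.mpr hb
  induction hw using Submodule.span_induction with
  | mem x hx =>
    obtain ⟨a, _, rfl⟩ := List.mem_map.mp hx
    simp only [elim, pivot]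
    field_simp
    ring
  | zero => rfl
  | add x y _ _ hx hy => simp [hx, hy]
  | smul c x _ hx => simp [hx]

/-- The linear map w ↦ w - (w i - w j) • pivot kills `b`, sends every other row to its eliminated
version, and fixes the vectors with w i = w j. Elimination therefore spans the whole hyperplane
section. -/
theorem mem_span_elim {n : ℕ} {rows : List (Fin n → ℝ)} {k : ℕ} {b : Fin n → ℝ}
    (h : rows[k]? = some b) {i j : Fin n} (hb : b i ≠ b j) {w : Fin n → ℝ}
    (hw : w ∈ Submodule.span ℝ {x | x ∈ rows}) (hij : w i = w j) :
    w ∈ Submodule.span ℝ {x | x ∈ (rows.eraseIdx k).map (elim b i j)} := by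
  have hb' := sub_ne_zero.mpr hb
  have : ∀ w ∈ Submodule.span ℝ {x | x ∈ rows},
      w - (w i - w j) • pivot b i j ∈
        Submodule.span ℝ {x | x ∈ (rows.eraseIdx k).map (elim b i j)} := by
    intro w hw
    induction hw using Submodule.span_induction with
    | mem x hx =>
      rcases (mem_iff_eq_or_mem_eraseIdx h x).mp hx with rfl | hx
      · convert Submodule.zero_mem _
        ext y
        simp only [pivot, Pi.sub_apply, Pi.smul_apply, smul_eq_mul, Pi.zero_apply]
        field_simp
        ring
      · exact Submodule.subset_span (List.mem_map.mpr ⟨x, hx, rfl⟩)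
    | zero => simp
    | add x y _ _ hx hy =>
      convert Submodule.add_mem _ hx hy using 1
      ext z
      simp only [Pi.sub_apply, Pi.smul_apply, Pi.add_apply, smul_eq_mul]
      ring
    | smul c x _ hx =>
      convert Submodule.smul_mem _ c hx using 1
      ext z
      simp only [Pi.sub_apply, Pi.smul_apply, smul_eq_mul]
      ring
  simpa [hij] using this w hw

/-- Every cell is found along some elimination path. -/
theorem exists_candidate {n : ℕ} (hn : 0 < n) (m : ℕ) (rows ks : List (Fin n → ℝ))
    (hm : rows.length = m + 1) (v : Fin n → ℝ) (hv : v ∈ Submodule.span ℝ {x | x ∈ rows})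
    (hg : IsGenericIn (Submodule.span ℝ {x | x ∈ rows}) v) :
    ∃ K, Candidate rows ks K ∧ ∀ x y, LexBefore K x y ↔ LexBefore (v :: ks) x y := by
  induction m generalizing rows ks v with
  | zero =>
    obtain ⟨a, rfl⟩ := List.length_eq_one_iff.mp hm
    simp only [List.mem_singleton, Set.ofPred_eq_eq_singleton] at hv hg
    obtain ⟨c, rfl⟩ := Submodule.mem_span_singleton.mp hv
    rcases lt_trichotomy c 0 with hc | hc | hc
    · refine ⟨_, .baseNeg a ks, fun x y => ?_⟩
      simp only [LexBefore, Pi.neg_apply, Pi.smul_apply, smul_eq_mul, neg_le_neg_iff,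
        neg_lt_neg_iff, mul_le_mul_left_of_neg hc, mul_lt_mul_left_of_neg hc]
    · refine ⟨_, .base a ks, fun x y => ?_⟩
      have := hg x y (by simp [hc]) a (Submodule.mem_span_singleton_self a)
      simp [LexBefore, hc, this]
    · refine ⟨_, .base a ks, fun x y => ?_⟩
      simp only [LexBefore, Pi.smul_apply, smul_eq_mul, mul_le_mul_iff_right₀ hc,
        mul_lt_mul_iff_right₀ hc]
  | succ m ih =>
    by_cases hne : ∃ x y, v x ≠ v y
    · obtain ⟨i, j, hij, v', hv', hvij, hlt, hprop⟩ := exists_facet hv hg hne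
      obtain ⟨b, hb, hbij⟩ : ∃ b ∈ rows, b i ≠ b j := by
        by_contra! hall
        refine hij.ne' ?_
        have : Submodule.span ℝ {x | x ∈ rows} ≤ LinearMap.ker (gapDual 1 0 i i i j) := by
          rw [Submodule.span_le]
          intro x hx
          simp [gapDual_apply, hall x hx]
        simpa [gapDual_apply, sub_eq_zero] using this hv
      obtain ⟨k, hk⟩ := List.mem_iff_getElem?.mp hb
      have hk' : k < rows.length := (List.getElem?_eq_some_iff.mp hk).1
      obtain ⟨K, hK, hlex⟩ := ih ((rows.eraseIdx k).map (elim b i j)) (pivot b i j :: ks)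
        (by rw [List.length_map, List.length_eraseIdx_of_lt hk', hm]; rfl) v'
        (mem_span_elim hk hbij hv' hvij) (by
          intro x y hxy w hw
          have h1 := hprop x y hxy w (span_elim_le hk hw)
          rw [apply_eq_of_mem_span_elim hbij hw, sub_self, mul_zero] at h1
          rcases mul_eq_zero.mp h1 with h1 | h1
          · exact sub_eq_zero.mp h1
          · exact absurd h1 (sub_pos.mpr hij).ne')
      refine ⟨K, .step i j (by omega) hk hK, fun x y => (hlex x y).trans ?_⟩
      simp only [LexBefore]
      -- Strict inequalities of `v'` hold for `v` as well. On a tie of `v'`, `hprop` at `b` shows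
      -- that the gap of `v` is the positive number v i - v j times the gap of the pivot, so both
      -- compare alike and pass the same ties on to `ks`.
      rcases lt_trichotomy (v' x) (v' y) with h | h | h
      · have := hlt y x h
        simp [h.not_ge, this.not_ge]
      · have h1 := hprop x y h b (Submodule.subset_span hb)
        have h2 : v x - v y = (v i - v j) * (pivot b i j x - pivot b i j y) := by
          have hb' := sub_ne_zero.mpr hbij
          simp only [pivot]
          field_simp
          linarith
        have h3 : v y ≤ v x ↔ pivot b i j y ≤ pivot b i j x := by
          rw [← sub_nonneg, h2, mul_nonneg_iff_of_pos_left (sub_pos.mpr hij), sub_nonneg]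
        have h4 : v y < v x ↔ pivot b i j y < pivot b i j x := by
          rw [← sub_pos, h2, mul_pos_iff_of_pos_left (sub_pos.mpr hij), sub_pos]
        simp [h, h3, h4]
      · have := hlt x y h
        simp [h, this, h.le, this.le]
    · push Not at hne
      have hk : rows[0]? = some (rows[0]'(by omega)) := List.getElem?_eq_getElem _
      set b := rows[0]'(by omega)
      have hb : b ∈ Submodule.span ℝ {x | x ∈ rows} :=
        Submodule.subset_span (List.mem_of_getElem? hk)
      -- If `v` is constant, so is every vector of the span and no facet exists. Eliminating with
      -- the pair `(i, i)` is a dummy step: its pivot is a quotient by zero, hence zero, and adds no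
      -- information.
      let i : Fin n := ⟨0, hn⟩
      obtain ⟨K, hK, hlex⟩ := ih ((rows.eraseIdx 0).map (elim b i i)) (pivot b i i :: ks)
        (by rw [List.length_map, List.length_eraseIdx_of_lt (by omega), hm]; rfl) 0
        (Submodule.zero_mem _)
        (fun x y _ w hw => hg x y (hne x y) w (span_elim_le hk hw))
      refine ⟨K, .step i i (by omega) hk hK, fun x y => (hlex x y).trans ?_⟩
      simp [LexBefore, hne x y, hg x y (hne x y) b hb, pivot]

/-! ## Counting candidates -/

/-- Each step chooses a pivot row among m + 2 and a pair among n², so the constant is multiplied by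
m + 2 and the exponent grows by two; the 2 of the base case counts the signs. -/
theorem exists_finset_candidates (m : ℕ) : ∃ C : ℕ, ∀ (n : ℕ) (rows ks : List (Fin n → ℝ)),
    rows.length = m + 1 → ∃ L : Finset (List (Fin n → ℝ)),
      L.card ≤ C * n ^ (2 * m) ∧ ∀ K, Candidate rows ks K → K ∈ L := by
  classical
  induction m with
  | zero =>
    refine ⟨2, fun n rows ks h => ?_⟩
    obtain ⟨a, rfl⟩ := List.length_eq_one_iff.mp h
    refine ⟨{a :: ks, (-a) :: ks}, by simpa using Finset.card_le_two, fun K hK => ?_⟩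
    cases hK with
    | base => simp
    | baseNeg => simp
    | step _ _ h2 => simp at h2
  | succ m ih =>
    obtain ⟨C, hC⟩ := ih
    refine ⟨(m + 2) * C, fun n rows ks h => ?_⟩
    have : ∀ (k : Fin (m + 2)) (i j : Fin n), ∃ L : Finset (List (Fin n → ℝ)),
        L.card ≤ C * n ^ (2 * m) ∧ ∀ K b, rows[(k : ℕ)]? = some b →
          Candidate ((rows.eraseIdx k).map (elim b i j)) (pivot b i j :: ks) K → K ∈ L := by
      intro k i j
      obtain ⟨L, hL, hmem⟩ := hC n
        ((rows.eraseIdx k).map (elim (rows[(k : ℕ)]'(by omega)) i j))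
        (pivot (rows[(k : ℕ)]'(by omega)) i j :: ks)
        (by rw [List.length_map, List.length_eraseIdx_of_lt (by omega), h]; rfl)
      refine ⟨L, hL, fun K b hb hK => hmem K ?_⟩
      obtain ⟨_, rfl⟩ := List.getElem?_eq_some_iff.mp hb
      exact hK
    choose L hL hmem using this
    refine ⟨Finset.univ.biUnion fun q : Fin (m + 2) × Fin n × Fin n => L q.1 q.2.1 q.2.2, ?_, ?_⟩
    · refine (Finset.card_biUnion_le_card_mul _ _ (C * n ^ (2 * m)) fun q _ => hL _ _ _).trans ?_
      simp only [Finset.card_univ, Fintype.card_prod, Fintype.card_fin]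
      apply le_of_eq
      ring
    · intro K hK
      obtain ⟨k, i, j, b, hb, hK⟩ := hK.exists_step (by omega)
      have hk : k < m + 2 := h ▸ (List.getElem?_eq_some_iff.mp hb).1
      exact Finset.mem_biUnion.mpr ⟨(⟨k, hk⟩, i, j), Finset.mem_univ _, hmem ⟨k, hk⟩ i j K b hb hK⟩

/-! ## Supports of sorted vectors -/

/-- The set of the first `a` and the last `c` elements in the order `σ`. -/
def endsSet {n : ℕ} (σ : Equiv.Perm (Fin n)) (a c : ℕ) : Finset (Fin n) :=
  Finset.univ.filter fun j => (σ.symm j : ℕ) < a ∨ n ≤ σ.symm j + c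

/-- An initial segment of `Fin n` is described by its length. -/
theorem exists_lt_iff_of_antitone {n : ℕ} (p : Fin n → Prop) (hp : ∀ i j, i ≤ j → p j → p i) :
    ∃ a ≤ n, ∀ i : Fin n, p i ↔ (i : ℕ) < a := by
  classical
  by_cases h : ∃ a, ∃ ha : a < n, ¬ p ⟨a, ha⟩
  · refine ⟨Nat.find h, (Nat.find_spec h).1.le, fun i => ⟨fun hi => ?_, fun hi => ?_⟩⟩
    · by_contra hle
      obtain ⟨ha, hna⟩ := Nat.find_spec h
      exact hna (hp ⟨_, ha⟩ i (Fin.le_def.mpr (not_lt.mp hle)) hi)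
    · by_contra hni
      exact Nat.find_min h hi ⟨i.2, hni⟩
  · push Not at h
    exact ⟨n, le_rfl, fun i => ⟨fun _ => i.2, fun _ => h i i.2⟩⟩

theorem exists_support_eq_endsSet {n : ℕ} {σ : Equiv.Perm (Fin n)} {x : Fin n → ℝ}
    (hx : x ∈ sortedCone σ) :
    ∃ a ≤ n, ∃ c ≤ n, Function.support x = (endsSet σ a c : Set (Fin n)) := by
  obtain ⟨a, ha, h1⟩ := exists_lt_iff_of_antitone (fun i => 0 < x (σ i))
    (fun i j hij hj => hj.trans_le (hx i j hij))
  obtain ⟨b, hb, h2⟩ := exists_lt_iff_of_antitone (fun i => 0 ≤ x (σ i))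
    (fun i j hij hj => le_trans hj (hx i j hij))
  -- The first `a` entries are positive and the first `b` are nonnegative, so the negative ones are
  -- the last `n - b`.
  refine ⟨a, ha, n - b, by omega, ?_⟩
  ext j
  have h1 := h1 (σ.symm j)
  have h2 := h2 (σ.symm j)
  rw [Equiv.apply_symm_apply] at h1 h2
  simp only [Function.mem_support, endsSet, Finset.coe_filter, Finset.mem_univ, true_and,
    Set.mem_ofPred_eq, ← h1]
  have h3 : n ≤ σ.symm j + (n - b) ↔ ¬ ((σ.symm j : ℕ) < b) := by omega
  rw [h3, ← h2, not_le, ne_iff_lt_or_gt, or_comm]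

/-! ## Convex maximization -/

/-- A convex function on `ℝʳ` has a subgradient at every point. -/
theorem ConvexOn.exists_subgradient {r : ℕ} {f : (Fin r → ℝ) → ℝ} (hf : ConvexOn ℝ Set.univ f)
    (y₀ : Fin r → ℝ) : ∃ g : Fin r → ℝ, ∀ y, f y₀ + g ⬝ᵥ (y - y₀) ≤ f y := by
  have hcont : Continuous f := by
    rw [← continuousOn_univ]
    exact hf.continuousOn isOpen_univ
  have hopen : IsOpen {p : (Fin r → ℝ) × ℝ | p.1 ∈ Set.univ ∧ f p.1 < p.2} := by
    simp only [Set.mem_univ, true_and]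
    exact isOpen_lt (hcont.comp continuous_fst) continuous_snd
  obtain ⟨φ, hφ⟩ := geometric_hahn_banach_point_open (x := (y₀, f y₀)) hf.convex_strict_epigraph
    hopen (by simp)
  simp only [Set.mem_univ, true_and, Set.mem_ofPred_eq, Prod.forall] at hφ
  set c := φ (0, 1) with hc
  have split : ∀ y t, φ (y, t) = φ (y, 0) + t * c := by
    intro y t
    have : ((y, t) : (Fin r → ℝ) × ℝ) = (y, 0) + t • (0, 1) := by simp
    rw [this, map_add, map_smul, smul_eq_mul]
  have hc0 : 0 < c := by
    -- Testing the separating functional vertically above the point shows that the hyperplane is not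
    -- vertical, so it is the graph of an affine minorant.
    have := hφ y₀ (f y₀ + 1) (by linarith)
    rw [split y₀, split y₀ (f y₀ + 1)] at this
    linarith
  have hle : ∀ y, φ (y₀, 0) + f y₀ * c ≤ φ (y, 0) + f y * c := by
    intro y
    refine le_of_forall_pos_lt_add fun ε hε => ?_
    have := hφ y (f y + ε / c) (by linarith [div_pos hε hc0])
    rw [split y₀, split y, add_mul, div_mul_cancel₀ _ hc0.ne'] at this
    linarith
  refine ⟨fun i => -(φ (Pi.single i 1, 0) / c), fun y => ?_⟩
  have hsum : ∀ z : Fin r → ℝ, φ (z, 0) = ∑ i, z i * φ (Pi.single i 1, 0) := by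
    intro z
    have := LinearMap.pi_apply_eq_sum_univ
      (φ.toLinearMap.comp (LinearMap.inl ℝ (Fin r → ℝ) ℝ)) z
    have e : ∀ i : Fin r, (Pi.single i 1 : Fin r → ℝ) = fun j => if i = j then 1 else 0 := by
      intro i
      ext j
      simp [Pi.single_apply, eq_comm]
    simp only [e]
    simpa using this
  have hdot : (fun i => -(φ (Pi.single i 1, 0) / c)) ⬝ᵥ (y - y₀) =
      (φ (y₀, 0) - φ (y, 0)) / c := by
    rw [hsum y, hsum y₀, ← Finset.sum_sub_distrib, Finset.sum_div]
    refine Finset.sum_congr rfl fun i _ => ?_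
    simp only [Pi.sub_apply]
    ring
  rw [hdot, ← le_sub_iff_add_le', div_le_iff₀ hc0]
  linarith [hle y]

/-- The rows of a matrix. -/
def rowList {r n : ℕ} (A : Matrix (Fin r) (Fin n) ℝ) : List (Fin n → ℝ) := List.ofFn fun i => A.row i

/-- Some optimal solution is sorted by the permutation that the mapping `Ψ` assigns to one of the
candidate orders. -/
theorem exists_candidate_isOptimal {m n : ℕ} (hn : 0 < n) (A : Matrix (Fin (m + 1)) (Fin n) ℝ)
    {X : Set (Fin n → ℝ)} {f : (Fin (m + 1) → ℝ) → ℝ}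
    {Ψ : Equiv.Perm (Fin n) → Equiv.Perm (Fin n)} (hX : ComonotoneVia Ψ X)
    (hf : ConvexOn ℝ Set.univ f) (hopt : ∃ x, IsOptimal (fun y => f (A *ᵥ y)) X x) :
    ∃ K, Candidate (rowList A) [] K ∧ ∃ a ≤ n, ∃ c ≤ n, ∃ x,
      IsOptimal (fun y => f (A *ᵥ y)) X x ∧
        Function.support x = (endsSet (Ψ (lexPerm K)) a c : Set (Fin n)) := by
  obtain ⟨x₀, hx₀, hmax⟩ := hopt
  obtain ⟨g, hg⟩ := hf.exists_subgradient (A *ᵥ x₀)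
  simp only [dotProduct_sub, dotProduct_mulVec] at hg
  have hu : g ᵥ* A ∈ Submodule.span ℝ {x | x ∈ rowList A} := by
    rw [vecMul_eq_sum]
    refine Submodule.sum_mem _ fun i _ => Submodule.smul_mem _ _ (Submodule.subset_span ?_)
    exact List.mem_ofFn.mpr ⟨i, rfl⟩
  obtain ⟨v, hv, hgen, hlt⟩ := exists_isGenericIn _ hu
  obtain ⟨K, hK, hlex⟩ := exists_candidate hn m (rowList A) [] (List.length_ofFn) v hv hgen
  have hsort : g ᵥ* A ∈ sortedCone (lexPerm K) := mem_sortedCone_lexPerm fun x y hxy =>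
    (hlex x y).mpr ⟨(hlt x y hxy).le, Or.inl (hlt x y hxy)⟩
  -- The linear problem attains its maximum at `x₀`: a larger value of gᵀA would give a larger value
  -- of `f` by the subgradient inequality.
  obtain ⟨x, hxs, hxX, hxmax⟩ := hX (lexPerm K) _ hsort ⟨x₀, hx₀, fun y hy => by
    have h1 := hg (A *ᵥ y)
    have h2 := hmax y hy
    simp only [dotProduct_mulVec] at h1 h2 ⊢
    linarith⟩
  obtain ⟨a, ha, c, hc, hsupp⟩ := exists_support_eq_endsSet hxs
  refine ⟨K, hK, a, ha, c, hc, x, ⟨hxX, fun y hy => (hmax y hy).trans ?_⟩, hsupp⟩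
  have h1 := hg (A *ᵥ x)
  have h2 := hxmax x₀ hx₀
  simp only [dotProduct_mulVec] at h1 h2 ⊢
  linarith

/-- The collection of candidate supports. -/
theorem exists_candidate_supports (m : ℕ) : ∃ C : ℕ, ∀ (n : ℕ), 0 < n →
    ∀ (A : Matrix (Fin (m + 1)) (Fin n) ℝ) (Ψ : Equiv.Perm (Fin n) → Equiv.Perm (Fin n)),
      ∃ L : Finset (Finset (Fin n)), L.card ≤ C * n ^ (2 * (m + 1)) ∧
        ∀ (X : Set (Fin n → ℝ)) (f : (Fin (m + 1) → ℝ) → ℝ),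
          ComonotoneVia Ψ X → ConvexOn ℝ Set.univ f →
          (∃ x, IsOptimal (fun y => f (A *ᵥ y)) X x) →
            ∃ S ∈ L, ∃ x, IsOptimal (fun y => f (A *ᵥ y)) X x ∧
              Function.support x = (S : Set (Fin n)) := by
  classical
  obtain ⟨C, hC⟩ := exists_finset_candidates m
  refine ⟨C * 4, fun n hn A Ψ => ?_⟩
  obtain ⟨L, hL, hmem⟩ := hC n (rowList A) [] (List.length_ofFn)
  refine ⟨(L ×ˢ Finset.range (n + 1) ×ˢ Finset.range (n + 1)).image
    fun q => endsSet (Ψ (lexPerm q.1)) q.2.1 q.2.2, ?_, fun X f hX hf hopt => ?_⟩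
  · refine Finset.card_image_le.trans ?_
    simp only [Finset.card_product, Finset.card_range]
    calc L.card * ((n + 1) * (n + 1)) ≤ (C * n ^ (2 * m)) * ((2 * n) * (2 * n)) := by
          gcongr <;> omega
      _ = C * 4 * n ^ (2 * (m + 1)) := by ring
  · obtain ⟨K, hK, a, ha, c, hc, x, hx, hsupp⟩ := exists_candidate_isOptimal hn A hX hf hopt
    refine ⟨_, Finset.mem_image.mpr ⟨(K, a, c), ?_, rfl⟩, x, hx, hsupp⟩
    simp only [Finset.mem_product, Finset.mem_range]
    exact ⟨hmem K hK, by omega, by omega⟩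

namespace RealRAM

/-! ## Total correctness with running times -/

variable {n : ℕ} {O : Oracles n}

/-- Program `p` halts on `s` after at most `B` steps in a memory that satisfies `Q`. -/
def Runs (O : Oracles n) (p : Program) (s : Store) (B : ℕ) (Q : Store → Prop) : Prop :=
  ∃ t s', Exec O p s t s' ∧ t ≤ B ∧ Q s'

/-- The integer arrays that a program may change. -/
def Program.natWrites : Program → Set ℕ
  | .skip => ∅
  | .setNat a _ _ => {a}
  | .setReal _ _ _ => ∅
  | .seq p q => p.natWrites ∪ q.natWrites
  | .cond _ p q => p.natWrites ∪ q.natWrites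
  | .loop _ p => p.natWrites
  | .askPerm _ dst => {dst}
  | .askSupp _ _ _ flag => {flag}

/-- The real arrays that a program may change. -/
def Program.realWrites : Program → Set ℕ
  | .skip => ∅
  | .setNat _ _ _ => ∅
  | .setReal a _ _ => {a}
  | .seq p q => p.realWrites ∪ q.realWrites
  | .cond _ p q => p.realWrites ∪ q.realWrites
  | .loop _ p => p.realWrites
  | .askPerm _ _ => ∅
  | .askSupp _ dst val _ => {dst, val}

@[simp] theorem Store.writeNat_nat_self (s : Store) (a i k : ℕ) :
    (s.writeNat a i k).nat a i = k := by simp [Store.writeNat]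

theorem Store.writeNat_nat_of_index_ne (s : Store) (a : ℕ) {i j : ℕ} (h : j ≠ i) (k : ℕ) :
    (s.writeNat a i k).nat a j = s.nat a j := by simp [Store.writeNat, h]

theorem Store.writeNat_nat_of_ne (s : Store) {a b : ℕ} (h : b ≠ a) (i k : ℕ) :
    (s.writeNat a i k).nat b = s.nat b := by
  ext j
  simp [Store.writeNat, h]

@[simp] theorem Store.writeNat_real (s : Store) (a i k : ℕ) :
    (s.writeNat a i k).real = s.real := rfl

@[simp] theorem Store.writeReal_nat (s : Store) (a i : ℕ) (z : ℝ) :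
    (s.writeReal a i z).nat = s.nat := rfl

@[simp] theorem Store.writeReal_real_self (s : Store) (a i : ℕ) (z : ℝ) :
    (s.writeReal a i z).real a i = z := by simp [Store.writeReal]

theorem Store.writeReal_real_of_index_ne (s : Store) (a : ℕ) {i j : ℕ} (h : j ≠ i) (z : ℝ) :
    (s.writeReal a i z).real a j = s.real a j := by simp [Store.writeReal, h]

theorem Store.writeReal_real_of_ne (s : Store) {a b : ℕ} (h : b ≠ a) (i : ℕ) (z : ℝ) :
    (s.writeReal a i z).real b = s.real b := by
  ext j
  simp [Store.writeReal, h]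

theorem Store.writeVec_real_of_ne (s : Store) {a b : ℕ} (h : b ≠ a) (x : Fin n → ℝ) :
    (s.writeVec a x).real b = s.real b := by
  ext j
  simp [Store.writeVec, h]

@[simp] theorem Store.readVec_writeVec (s : Store) (a : ℕ) (x : Fin n → ℝ) :
    (s.writeVec a x).readVec a n = x := by
  ext j
  simp [Store.writeVec, Store.readVec]

theorem Store.writePerm_nat_of_ne (s : Store) {a b : ℕ} (h : b ≠ a) (π : Equiv.Perm (Fin n)) :
    (s.writePerm a π).nat b = s.nat b := by
  ext j
  simp [Store.writePerm, h]

theorem Store.holdsPerm_writePerm (s : Store) (a : ℕ) (π : Equiv.Perm (Fin n)) :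
    (s.writePerm a π).HoldsPerm a π := by
  intro j
  simp [Store.writePerm]

theorem Store.receive_nat_of_ne (s : Store) (dst val : ℕ) {flag b : ℕ} (h : b ≠ flag)
    (o : Option ((Fin n → ℝ) × ℝ)) : (s.receive dst val flag o).nat b = s.nat b := by
  cases o with
  | none => exact s.writeNat_nat_of_ne h 0 0
  | some xz => exact Store.writeNat_nat_of_ne _ h 0 1

theorem Store.receive_real_of_ne (s : Store) {dst val b : ℕ} (flag : ℕ) (h : b ≠ dst)
    (h' : b ≠ val) (o : Option ((Fin n → ℝ) × ℝ)) :
    (s.receive dst val flag o).real b = s.real b := by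
  cases o with
  | none => rfl
  | some xz =>
    simp only [Store.receive, Store.writeNat_real]
    rw [Store.writeReal_real_of_ne _ h', Store.writeVec_real_of_ne _ h]

/-- A program leaves the integer arrays unchanged to which it does not write. -/
theorem Exec.nat_eq {p : Program} {s s' : Store} {t : ℕ} (h : Exec O p s t s') :
    ∀ a ∉ p.natWrites, s'.nat a = s.nat a := by
  induction h with
  | skip | setReal | loopDone => intros; rfl
  | setNat => exact fun b hb => Store.writeNat_nat_of_ne _ hb _ _
  | seq _ _ ih₁ ih₂ =>
    exact fun b hb => (ih₂ b fun h => hb (Or.inr h)).trans (ih₁ b fun h => hb (Or.inl h))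
  | condTrue _ _ ih => exact fun b hb => ih b fun h => hb (Or.inl h)
  | condFalse _ _ ih => exact fun b hb => ih b fun h => hb (Or.inr h)
  | loopStep _ _ _ ih₁ ih₂ => exact fun b hb => (ih₂ b hb).trans (ih₁ b hb)
  | askPerm => exact fun b hb => Store.writePerm_nat_of_ne _ hb _
  | askSupp => exact fun b hb => Store.receive_nat_of_ne _ _ _ hb _

/-- A program leaves the real arrays unchanged to which it does not write. -/
theorem Exec.real_eq {p : Program} {s s' : Store} {t : ℕ} (h : Exec O p s t s') :
    ∀ a ∉ p.realWrites, s'.real a = s.real a := by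
  induction h with
  | skip | setNat | loopDone | askPerm => intros; rfl
  | setReal => exact fun b hb => Store.writeReal_real_of_ne _ hb _ _
  | seq _ _ ih₁ ih₂ =>
    exact fun b hb => (ih₂ b fun h => hb (Or.inr h)).trans (ih₁ b fun h => hb (Or.inl h))
  | condTrue _ _ ih => exact fun b hb => ih b fun h => hb (Or.inl h)
  | condFalse _ _ ih => exact fun b hb => ih b fun h => hb (Or.inr h)
  | loopStep _ _ _ ih₁ ih₂ => exact fun b hb => (ih₂ b hb).trans (ih₁ b hb)
  | askSupp =>
    exact fun b hb => Store.receive_real_of_ne _ _ (fun h => hb (Or.inl h))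
      (fun h => hb (Or.inr h)) _

theorem Runs.mono {p : Program} {s : Store} {B B' : ℕ} {Q Q' : Store → Prop}
    (h : Runs O p s B Q) (hB : B ≤ B') (hQ : ∀ s', Q s' → Q' s') : Runs O p s B' Q' := by
  obtain ⟨t, s', he, ht, hq⟩ := h
  exact ⟨t, s', he, ht.trans hB, hQ s' hq⟩

/-- Frame rule: facts about arrays that a program does not write need not be carried through its
specification. -/
theorem Runs.frame {p : Program} {s : Store} {B : ℕ} {Q : Store → Prop} (h : Runs O p s B Q) :
    Runs O p s B fun s' => Q s' ∧ (∀ a ∉ p.natWrites, s'.nat a = s.nat a) ∧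
      ∀ a ∉ p.realWrites, s'.real a = s.real a := by
  obtain ⟨t, s', he, ht, hq⟩ := h
  exact ⟨t, s', he, ht, hq, he.nat_eq, he.real_eq⟩

theorem Runs.skip {s : Store} {Q : Store → Prop} (h : Q s) : Runs O .skip s 1 Q :=
  ⟨1, s, .skip s, le_rfl, h⟩

theorem Runs.setNat {a : ℕ} {i e : NExp} {s : Store} {Q : Store → Prop}
    (h : Q (s.writeNat a (i.eval s) (e.eval s))) :
    Runs O (.setNat a i e) s (i.cost + e.cost + 1) Q :=
  ⟨_, _, .setNat a i e s, le_rfl, h⟩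

theorem Runs.setReal {a : ℕ} {i : NExp} {e : RExp} {s : Store} {Q : Store → Prop}
    (h : Q (s.writeReal a (i.eval s) (e.eval s))) :
    Runs O (.setReal a i e) s (i.cost + e.cost + 1) Q :=
  ⟨_, _, .setReal a i e s, le_rfl, h⟩

theorem Runs.seq {p q : Program} {s : Store} {B₁ B₂ : ℕ} {Q₁ Q₂ : Store → Prop}
    (h₁ : Runs O p s B₁ Q₁) (h₂ : ∀ s', Q₁ s' → Runs O q s' B₂ Q₂) :
    Runs O (.seq p q) s (B₁ + B₂) Q₂ := by
  obtain ⟨t₁, s₁, he₁, ht₁, hq₁⟩ := h₁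
  obtain ⟨t₂, s₂, he₂, ht₂, hq₂⟩ := h₂ s₁ hq₁
  exact ⟨_, s₂, .seq he₁ he₂, Nat.add_le_add ht₁ ht₂, hq₂⟩

theorem Runs.cond {b : BExp} {p q : Program} {s : Store} {B : ℕ} {Q : Store → Prop}
    (h₁ : b.holds s → Runs O p s B Q) (h₂ : ¬ b.holds s → Runs O q s B Q) :
    Runs O (.cond b p q) s (b.cost + B) Q := by
  by_cases hb : b.holds s
  · obtain ⟨t, s', he, ht, hq⟩ := h₁ hb
    exact ⟨_, s', .condTrue hb he, Nat.add_le_add le_rfl ht, hq⟩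
  · obtain ⟨t, s', he, ht, hq⟩ := h₂ hb
    exact ⟨_, s', .condFalse hb he, Nat.add_le_add le_rfl ht, hq⟩

theorem Runs.askSupp {src dst val flag : ℕ} {s : Store} {Q : Store → Prop}
    (h : Q (s.receive dst val flag (O.supp (s.readSet src n)))) :
    Runs O (.askSupp src dst val flag) s O.suppTime Q :=
  ⟨_, _, .askSupp src dst val flag s, le_rfl, h⟩

theorem Runs.askPerm {src dst : ℕ} {s : Store} {Q : Store → Prop} {π : Equiv.Perm (Fin n)}
    (hπ : s.HoldsPerm src π) (h : Q (s.writePerm dst (O.perm π))) :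
    Runs O (.askPerm src dst) s O.permTime Q :=
  ⟨_, _, .askPerm hπ, le_rfl, h⟩

/-- The integer variable stored in entry `0` of array `a`. -/
abbrev var (a : ℕ) : NExp := .get a (.const 0)

/-- Run `p` for the values `0, 1, …` smaller than `e` of the variable `c`. -/
def Program.forLoop (c : ℕ) (e : NExp) (p : Program) : Program :=
  .seq (.setNat c (.const 0) (.const 0))
    (.loop (.neg (.natLe e (var c)))
      (.seq p (.setNat c (.const 0) (.add (var c) (.const 1)))))

theorem Program.natWrites_forLoop (c : ℕ) (e : NExp) (p : Program) :
    (Program.forLoop c e p).natWrites = {c} ∪ p.natWrites := by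
  ext a
  simp only [Program.forLoop, Program.natWrites, Set.mem_union, Set.mem_singleton_iff]
  tauto

theorem Program.realWrites_forLoop (c : ℕ) (e : NExp) (p : Program) :
    (Program.forLoop c e p).realWrites = p.realWrites := by
  simp [Program.forLoop, Program.realWrites]

/-- `I k` is the invariant right after the counter has been set to `k`. Time is measured as a
constant times a unit `β`: test and increment are absorbed using 1 ≤ β, so nesting only multiplies
units and adds to the constant. `M` is any convenient bound on the number of passes. -/
theorem Runs.forLoop {c : ℕ} {e : NExp} {p : Program} {s : Store} {N M C β : ℕ}
    {I : ℕ → Store → Prop} (hNM : N ≤ M) (hM : 1 ≤ M) (hβ : 1 ≤ β) (hc : c ∉ p.natWrites)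
    (h₀ : I 0 (s.writeNat c 0 0)) (he : ∀ k s, I k s → e.eval s = N)
    (hstep : ∀ k s, k < N → s.nat c 0 = k → I k s →
      Runs O p s (C * β) fun s' => I (k + 1) (s'.writeNat c 0 (k + 1))) :
    Runs O (.forLoop c e p) s ((C + (2 * e.cost + 17)) * (M * β)) (I N) := by
  have main : ∀ d k s, k + d = N → s.nat c 0 = k → I k s →
      Runs O (.loop (.neg (.natLe e (var c)))
        (.seq p (.setNat c (.const 0) (.add (var c) (.const 1))))) s
        (d * (C * β + e.cost + 10) + (e.cost + 4)) (I N) := by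
    intro d
    induction d with
    | zero =>
      intro k s hk hs hI
      have hk : k = N := by omega
      subst hk
      refine ⟨_, s, .loopDone ?_, ?_, hI⟩
      · simp only [BExp.holds, NExp.eval, not_not, he _ s hI, hs, le_refl]
      · simp only [BExp.cost, NExp.cost]
        omega
    | succ d ih =>
      intro k s hk hs hI
      obtain ⟨t₁, s₁, he₁, ht₁, hQ₁⟩ := hstep k s (by omega) hs hI
      have hs₁ : s₁.nat c 0 = k := by rw [he₁.nat_eq c hc, hs]
      obtain ⟨t₂, s₂, he₂, ht₂, hQ₂⟩ := ih (k + 1) (s₁.writeNat c 0 (k + 1)) (by omega) (by simp)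
        hQ₁
      have hinc : Exec O (.setNat c (.const 0) (.add (var c) (.const 1))) s₁ 6
          (s₁.writeNat c 0 (k + 1)) := by
        rw [← hs₁]
        exact .setNat c (.const 0) (.add (var c) (.const 1)) s₁
      refine ⟨_, s₂, .loopStep ?_ (.seq he₁ hinc) he₂, ?_, hQ₂⟩
      · simp only [BExp.holds, NExp.eval, he _ s hI, hs]
        omega
      · simp only [BExp.cost, NExp.cost]
        rw [add_mul, one_mul]
        omega
  refine (Runs.seq (Runs.setNat (Q := fun s' => s' = s.writeNat c 0 0) rfl) fun s' hs' =>
    main N 0 s' (by omega) (by simp [hs']) (hs' ▸ h₀)).mono ?_ fun _ h => h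
  simp only [NExp.cost]
  have h1 : 1 ≤ M * β := Nat.mul_pos hM hβ
  calc 1 + 1 + 1 + (N * (C * β + e.cost + 10) + (e.cost + 4))
      ≤ M * (C * β + (e.cost + 10) * β) + (e.cost + 7) * (M * β) := by
        have h2 : N * (C * β + e.cost + 10) ≤ M * (C * β + (e.cost + 10) * β) := by
          refine Nat.mul_le_mul hNM ?_
          have := Nat.le_mul_of_pos_right (e.cost + 10) hβ
          omega
        have h3 := Nat.le_mul_of_pos_right (e.cost + 7) h1
        omega
    _ = (C + (2 * e.cost + 17)) * (M * β) := by ring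

/-- A loop all of whose passes preserve `J` and `D`, where `D` is established by any pass `k` for
which `hit k` holds. -/
theorem Runs.forLoop_hit {c : ℕ} {e : NExp} {p : Program} {s : Store} {N M C β : ℕ}
    {J D : Store → Prop} {hit : ℕ → Prop} (hNM : N ≤ M) (hM : 1 ≤ M) (hβ : 1 ≤ β)
    (hc : c ∉ p.natWrites) (hJc : ∀ s k, J s → J (s.writeNat c 0 k))
    (hDc : ∀ s k, D s → D (s.writeNat c 0 k)) (hs : J s) (he : ∀ s, J s → e.eval s = N)
    (hstep : ∀ k s, k < N → s.nat c 0 = k → J s →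
      Runs O p s (C * β) fun s' => J s' ∧ (D s → D s') ∧ (hit k → D s')) :
    Runs O (.forLoop c e p) s ((C + (2 * e.cost + 17)) * (M * β))
      fun s' => J s' ∧ (D s → D s') ∧ ∀ k < N, hit k → D s' := by
  refine Runs.forLoop (I := fun k s' => J s' ∧ (D s → D s') ∧ ∀ l < k, hit l → D s') hNM hM hβ hc
    ⟨hJc _ _ hs, hDc _ _, by simp⟩ (fun k s h => he s h.1) fun k s₁ hk hs₁ hI => ?_
  refine (hstep k s₁ hk hs₁ hI.1).mono le_rfl fun s₂ h => ⟨hJc _ _ h.1, ?_, ?_⟩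
  · exact fun hD => hDc _ _ (h.2.1 (hI.2.1 hD))
  · intro l hl hhit
    rcases Nat.lt_succ_iff_lt_or_eq.mp hl with hl | rfl
    · exact hDc _ _ (h.2.1 (hI.2.2 l hl hhit))
    · exact hDc _ _ (h.2.2 hhit)

/-- Sequential composition of a list of programs. -/
def Program.seqAll : List Program → Program
  | [] => .skip
  | p :: l => .seq p (seqAll l)

theorem Runs.seqAll_hit {β : ℕ} (hβ : 1 ≤ β) {body : ℕ → Program} {C : ℕ → ℕ}
    {J D : Store → Prop} {hit : ℕ → Prop} (l : List ℕ)
    (hstep : ∀ k ∈ l, ∀ s, J s →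
      Runs O (body k) s (C k * β) fun s' => J s' ∧ (D s → D s') ∧ (hit k → D s'))
    (s : Store) (hs : J s) :
    Runs O (.seqAll (l.map body)) s (((l.map C).sum + 1) * β)
      fun s' => J s' ∧ (D s → D s') ∧ ∀ k ∈ l, hit k → D s' := by
  induction l generalizing s with
  | nil => exact (Runs.skip ⟨hs, id, by simp⟩).mono (by simpa using hβ) fun _ h => h
  | cons k l ih =>
    refine (Runs.seq (hstep k (by simp) s hs) fun s₁ h₁ =>
      (ih (fun k hk => hstep k (by simp [hk])) s₁ h₁.1).mono le_rfl fun s₂ h₂ =>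
        (⟨h₂.1, fun hD => h₂.2.1 (h₁.2.1 hD), ?_⟩ :
          J s₂ ∧ (D s → D s₂) ∧ ∀ k' ∈ k :: l, hit k' → D s₂)).mono ?_ fun _ h => h
    · intro k' hk' hhit
      rcases List.mem_cons.mp hk' with rfl | hk'
      · exact h₂.2.1 (h₁.2.2 hhit)
      · exact h₂.2.2 k' hk' hhit
    · apply le_of_eq
      simp only [List.map_cons, List.sum_cons]
      ring

/-! ## Sorting by keys -/

/-- The vectors stored in a list of real arrays. -/
def Store.readVecs (s : Store) (l : List ℕ) (n : ℕ) : List (Fin n → ℝ) :=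
  l.map fun a => s.readVec a n

theorem Store.readVec_congr {s s' : Store} {a : ℕ} (n : ℕ) (h : s'.real a = s.real a) :
    s'.readVec a n = s.readVec a n := by
  ext j
  simp [Store.readVec, h]

theorem Store.readVecs_congr {s s' : Store} {l : List ℕ} (n : ℕ)
    (h : ∀ a ∈ l, s'.real a = s.real a) : s'.readVecs l n = s.readVecs l n :=
  List.map_congr_left fun a ha => Store.readVec_congr n (h a ha)

theorem Store.HoldsPerm.congr {n : ℕ} {s s' : Store} {a : ℕ} {π : Equiv.Perm (Fin n)}
    (hs : s.HoldsPerm a π) (h : s'.nat a = s.nat a) : s'.HoldsPerm a π := by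
  intro j
  rw [h, hs j]

/-- The test whether the value of variable `7` comes before the value of variable `6` in the order
given by the key arrays `ks`. -/
def lexTest : List ℕ → BExp
  | [] => .neg (.natLe (var 6) (var 7))
  | a :: ks => .conj (.realLe (.get a (var 6)) (.get a (var 7)))
      (.neg (.conj (.realLe (.get a (var 7)) (.get a (var 6))) (.neg (lexTest ks))))

theorem lexTest_holds {n : ℕ} {s : Store} (ks : List ℕ) {x y : Fin n} (hx : s.nat 7 0 = x)
    (hy : s.nat 6 0 = y) : (lexTest ks).holds s ↔ LexBefore (s.readVecs ks n) x y := by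
  induction ks with
  | nil => simp [lexTest, BExp.holds, NExp.eval, Store.readVecs, LexBefore, hx, hy]
  | cons a ks ih =>
    simp only [lexTest, BExp.holds, NExp.eval, RExp.eval, ih, hx, hy, Store.readVecs,
      List.map_cons, LexBefore, Store.readVec]
    rw [not_and_or, not_le, not_not]

/-- Store in the integer array `1` the permutation that sorts by the key arrays `ks`. -/
def sortKeys (ks : List ℕ) : Program :=
  .forLoop 6 (var 0) (.seq (.setNat 8 (.const 0) (.const 0)) (.seq
    (.forLoop 7 (var 0)
      (.cond (lexTest ks) (.setNat 8 (.const 0) (.add (var 8) (.const 1))) .skip))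
    (.setNat 1 (var 8) (var 6))))

theorem natWrites_sortKeys (ks : List ℕ) : (sortKeys ks).natWrites = {6, 8, 7, 1} := by
  ext a
  simp only [sortKeys, Program.natWrites_forLoop, Program.natWrites, Set.mem_union,
    Set.mem_singleton_iff, Set.mem_insert_iff, Set.mem_empty_iff_false]
  tauto

theorem realWrites_sortKeys (ks : List ℕ) : (sortKeys ks).realWrites = ∅ := by
  simp [sortKeys, Program.realWrites_forLoop, Program.realWrites]

open Classical in
/-- The number of the elements smaller than `k` that satisfy `p`. -/
noncomputable def countBelow {n : ℕ} (p : Fin n → Prop) (k : ℕ) : ℕ :=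
  (Finset.univ.filter fun y : Fin n => (y : ℕ) < k ∧ p y).card

theorem countBelow_succ_of_pos {n : ℕ} {p : Fin n → Prop} {x : Fin n} (h : p x) :
    countBelow p (x + 1) = countBelow p x + 1 := by
  classical
  unfold countBelow
  rw [← Finset.card_insert_of_notMem (a := x) (by simp)]
  congr 1
  ext y
  simp only [Finset.mem_filter, Finset.mem_univ, true_and, Finset.mem_insert, Nat.lt_succ_iff_lt_or_eq,
    Fin.val_inj]
  constructor
  · rintro ⟨h1 | h1, h2⟩
    · exact Or.inr ⟨h1, h2⟩
    · exact Or.inl h1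
  · rintro (rfl | ⟨h1, h2⟩)
    · exact ⟨Or.inr rfl, h⟩
    · exact ⟨Or.inl h1, h2⟩

theorem countBelow_succ_of_neg {n : ℕ} {p : Fin n → Prop} {x : Fin n} (h : ¬ p x) :
    countBelow p (x + 1) = countBelow p x := by
  classical
  unfold countBelow
  congr 1
  ext y
  simp only [Finset.mem_filter, Finset.mem_univ, true_and, Nat.lt_succ_iff_lt_or_eq, Fin.val_inj]
  constructor
  · rintro ⟨h1 | rfl, h2⟩
    · exact ⟨h1, h2⟩
    · exact absurd h2 h
  · exact fun ⟨h1, h2⟩ => ⟨Or.inl h1, h2⟩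

theorem countBelow_lexBefore {n : ℕ} (ks : List (Fin n → ℝ)) (x : Fin n) :
    countBelow (fun y => LexBefore ks y x) n = lexRank ks x := by
  unfold countBelow lexRank
  congr 1
  ext y
  simp

/-- The rank of each index is found by counting its predecessors, and the index is written at that
rank. Quadratic time is affordable because n² support queries follow for each permutation. -/
theorem runs_sortKeys (ks : List ℕ) : ∃ C : ℕ, ∀ (n : ℕ) (O : Oracles n) (s : Store), 1 ≤ n →
    s.nat 0 0 = n → Runs O (sortKeys ks) s (C * n ^ 2) fun s' =>
      s'.HoldsPerm 1 (lexPerm (s.readVecs ks n)) := by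
  refine ⟨3 + ((lexTest ks).cost + 6 + (2 * 2 + 17)) + 5 + (2 * 2 + 17), fun n O s hn hs => ?_⟩
  have outer : Runs O (sortKeys ks) s
      ((3 + ((lexTest ks).cost + 6 + (2 * 2 + 17)) + 5 + (2 * (var 0).cost + 17)) * (n * n))
      fun s' => s'.nat 0 0 = n ∧ s'.real = s.real ∧
        ∀ x : Fin n, (x : ℕ) < n → s'.nat 1 (lexRank (s.readVecs ks n) x) = x := by
    refine Runs.forLoop (I := fun i s' => s'.nat 0 0 = n ∧ s'.real = s.real ∧
      ∀ x : Fin n, (x : ℕ) < i → s'.nat 1 (lexRank (s.readVecs ks n) x) = x) (N := n)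
      le_rfl hn hn (by simp [Program.natWrites, Program.natWrites_forLoop])
      ⟨by simp [Store.writeNat, hs], rfl, by simp⟩ (fun k s h => h.1) ?_
    intro i s₁ hi hi₁ ⟨hn₁, hr₁, hI₁⟩
    obtain ⟨x, rfl⟩ : ∃ x : Fin n, (x : ℕ) = i := ⟨⟨i, hi⟩, rfl⟩
    have inner : ∀ s₂, s₂ = s₁.writeNat 8 0 0 → Runs O (.forLoop 7 (var 0)
        (.cond (lexTest ks) (.setNat 8 (.const 0) (.add (var 8) (.const 1))) .skip)) s₂
        (((lexTest ks).cost + 6 + (2 * (var 0).cost + 17)) * (n * 1))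
        fun s' => s'.nat 0 0 = n ∧ s'.real = s.real ∧ s'.nat 6 0 = x ∧ s'.nat 1 = s₁.nat 1 ∧
          s'.nat 8 0 = countBelow (fun y => LexBefore (s.readVecs ks n) y x) n := by
      intro s₂ hs₂
      refine Runs.forLoop (I := fun j s' => s'.nat 0 0 = n ∧ s'.real = s.real ∧
        s'.nat 6 0 = x ∧ s'.nat 1 = s₁.nat 1 ∧
          s'.nat 8 0 = countBelow (fun y => LexBefore (s.readVecs ks n) y x) j)
        le_rfl hn le_rfl (by simp [Program.natWrites]) ?_ (fun k s h => h.1) ?_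
      · subst hs₂
        exact ⟨by simp [Store.writeNat, hn₁], hr₁, by simp [Store.writeNat, hi₁],
          by simp [Store.writeNat], by simp [Store.writeNat, countBelow]⟩
      · intro j s₃ hj hj₃ ⟨hn₃, hr₃, hi₃, h1₃, h8₃⟩
        obtain ⟨y, rfl⟩ : ∃ y : Fin n, (y : ℕ) = j := ⟨⟨j, hj⟩, rfl⟩
        have hread : s₃.readVecs ks n = s.readVecs ks n :=
          Store.readVecs_congr n fun a _ => by rw [hr₃]
        have htest := lexTest_holds ks hj₃ hi₃
        rw [hread] at htest
        refine (Runs.cond (B := 6) (fun hb => ?_) fun hb => ?_).mono (by omega) fun _ h => h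
        · rw [htest] at hb
          refine (Runs.setNat ?_)
          refine ⟨by simp [Store.writeNat, hn₃], hr₃, by simp [Store.writeNat, hi₃],
            by simpa [Store.writeNat] using h1₃, ?_⟩
          rw [countBelow_succ_of_pos (p := fun y => LexBefore (s.readVecs ks n) y x) hb, ← h8₃]
          simp [Store.writeNat, NExp.eval]
        · rw [htest] at hb
          refine (Runs.skip ?_).mono (by omega) fun _ h => h
          refine ⟨by simp [Store.writeNat, hn₃], hr₃, by simp [Store.writeNat, hi₃],
            by simpa [Store.writeNat] using h1₃, ?_⟩
          rw [countBelow_succ_of_neg (p := fun y => LexBefore (s.readVecs ks n) y x) hb, ← h8₃]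
          simp [Store.writeNat]
    refine (Runs.seq (Runs.setNat (Q := fun s' => s' = s₁.writeNat 8 0 0) rfl) fun s₂ hs₂ =>
      Runs.seq (inner s₂ hs₂) fun s₃ hs₃ => Runs.setNat ?_).mono ?_ fun _ h => h
    · obtain ⟨hn₃, hr₃, hi₃, h1₃, h8₃⟩ := hs₃
      rw [countBelow_lexBefore] at h8₃
      refine ⟨by simp [Store.writeNat, hn₃], hr₃, fun y hy => ?_⟩
      rw [Store.writeNat_nat_of_ne _ (by norm_num)]
      simp only [NExp.eval, h8₃, hi₃]
      rcases Nat.lt_succ_iff_lt_or_eq.mp hy with hy | hy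
      · rw [Store.writeNat_nat_of_index_ne, h1₃, hI₁ y hy]
        -- Ranks are injective, as `lexPerm` inverts them, so entries written earlier survive.
        intro heq
        have := lexPerm_lexRank (s.readVecs ks n) y
        simp only [heq, lexPerm_lexRank] at this
        exact hy.ne' (congrArg Fin.val this)
      · obtain rfl := Fin.ext hy
        simp
    · simp only [NExp.cost, mul_one]
      linarith
  refine outer.mono (by simp only [NExp.cost]; rw [sq]) fun s' h j => ?_
  have := h.2.2 (lexPerm (s.readVecs ks n) j) (Fin.is_lt _)
  rwa [lexRank_lexPerm] at this

/-! ## Searching the supports of the vectors sorted by a permutation -/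

/-- Entry `0` of the integer array `5` tells whether a solution has been found; then the real
array `r` contains a solution returned by the oracle and entry `0` of the real array `r + 2` its
objective value. -/
def Incumbent {n : ℕ} (O : Oracles n) (r : ℕ) (s : Store) : Prop :=
  s.nat 5 0 ≠ 0 → ∃ S, O.supp S = some (s.readVec r n, s.real (r + 2) 0)

/-- A solution with objective value at least `z` has been found. -/
def Reaches (r : ℕ) (z : ℝ) (s : Store) : Prop :=
  s.nat 5 0 ≠ 0 ∧ z ≤ s.real (r + 2) 0

/-- The oracle knows a solution with support `S` and objective value at least `z`. -/
def AnswerGE {n : ℕ} (O : Oracles n) (z : ℝ) (S : Finset (Fin n)) : Prop :=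
  ∃ x w, O.supp S = some (x, w) ∧ z ≤ w

theorem Incumbent.congr {n : ℕ} {O : Oracles n} {r : ℕ} {s s' : Store} (h : Incumbent O r s)
    (h5 : s'.nat 5 = s.nat 5) (hr : s'.real r = s.real r)
    (hv : s'.real (r + 2) = s.real (r + 2)) : Incumbent O r s' := by
  rwa [Incumbent, h5, hv, Store.readVec_congr n hr]

theorem Reaches.congr {r : ℕ} {z : ℝ} {s s' : Store} (h : Reaches r z s)
    (h5 : s'.nat 5 = s.nat 5) (hv : s'.real (r + 2) = s.real (r + 2)) : Reaches r z s' := by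
  rwa [Reaches, h5, hv]

theorem Incumbent.writeNat {n : ℕ} {O : Oracles n} {r : ℕ} {s : Store} (h : Incumbent O r s)
    {a : ℕ} (ha : a ≠ 5) (i k : ℕ) : Incumbent O r (s.writeNat a i k) :=
  h.congr (Store.writeNat_nat_of_ne _ ha.symm _ _) rfl rfl

theorem Reaches.writeNat {r : ℕ} {z : ℝ} {s : Store} (h : Reaches r z s) {a : ℕ} (ha : a ≠ 5)
    (i k : ℕ) : Reaches r z (s.writeNat a i k) :=
  h.congr (Store.writeNat_nat_of_ne _ ha.symm _ _) rfl

/-- Query the oracle at the set stored in the integer array `3`, and once more if the answer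
improves on the incumbent solution, which it then replaces. -/
def trySupport (r : ℕ) : Program :=
  .seq (.askSupp 3 (r + 1) (r + 3) 4)
    (.cond (.conj (.natLe (.const 1) (var 4)) (.neg (.conj (.natLe (.const 1) (var 5))
        (.realLe (.get (r + 3) (.const 0)) (.get (r + 2) (.const 0))))))
      (.askSupp 3 r (r + 2) 5) .skip)

/-- An improving answer is stored by repeating the query with the incumbent as destination. Copying
the vector would cost n steps, which is not O(T₁) in general; repeating keeps each trial at O(T₁).
-/
theorem runs_trySupport {n : ℕ} {O : Oracles n} (hT : 1 ≤ O.suppTime) (r : ℕ) (z : ℝ) {s : Store}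
    (hs : Incumbent O r s) : Runs O (trySupport r) s (20 * O.suppTime) fun s' =>
      Incumbent O r s' ∧ (Reaches r z s → Reaches r z s') ∧
        (AnswerGE O z (s.readSet 3 n) → Reaches r z s') := by
  refine (Runs.seq (Runs.askSupp (Q := fun s' => s' = s.receive (r + 1) (r + 3) 4
    (O.supp (s.readSet 3 n))) rfl) fun s₁ hs₁ => Runs.cond (B := O.suppTime) ?_ ?_).mono
      (by simp only [BExp.cost, NExp.cost, RExp.cost]; omega) fun _ h => h
  · intro hb
    have hset : s₁.readSet 3 n = s.readSet 3 n := by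
      have : s₁.nat 3 = s.nat 3 := by rw [hs₁, Store.receive_nat_of_ne _ _ _ (by norm_num)]
      simp only [Store.readSet, this]
    refine Runs.askSupp ?_
    rw [hset]
    have hv : s₁.real (r + 2) = s.real (r + 2) := by
      rw [hs₁, Store.receive_real_of_ne _ _ (by omega) (by omega)]
    have h5 : s₁.nat 5 = s.nat 5 := by rw [hs₁, Store.receive_nat_of_ne _ _ _ (by norm_num)]
    simp only [BExp.holds, NExp.eval, RExp.eval, hv, h5] at hb
    cases ho : O.supp (s.readSet 3 n) with
    | none => simp [hs₁, ho, Store.receive] at hb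
    | some xw =>
      obtain ⟨x, w⟩ := xw
      have h3 : s₁.real (r + 3) 0 = w := by simp [hs₁, ho, Store.receive]
      have key : ∀ y, y = s₁.receive r (r + 2) 5 (some (x, w)) →
          y.nat 5 0 = 1 ∧ y.real (r + 2) 0 = w ∧ y.readVec r n = x := by
        rintro y rfl
        refine ⟨by simp [Store.receive], by simp [Store.receive], ?_⟩
        have : (s₁.receive r (r + 2) 5 (some (x, w))).real r = (s₁.writeVec r x).real r := by
          simp only [Store.receive, Store.writeNat_real]
          rw [Store.writeReal_real_of_ne _ (by omega)]
        rw [Store.readVec_congr n this, Store.readVec_writeVec]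
      obtain ⟨k1, k2, k3⟩ := key _ rfl
      refine ⟨fun _ => ⟨s.readSet 3 n, by rw [k2, k3, ho]⟩, fun h => ⟨by rw [k1]; norm_num, ?_⟩,
        fun ⟨x', w', h, hw⟩ => ⟨by rw [k1]; norm_num, ?_⟩⟩
      · rw [k2, ← h3]
        by_contra! hlt
        refine hb.2 ⟨Nat.one_le_iff_ne_zero.mpr h.1, ?_⟩
        exact (hlt.trans_le h.2).le
      · rw [ho] at h
        obtain ⟨rfl, rfl⟩ := Prod.mk.inj (Option.some.inj h)
        rwa [k2]
  · intro hb
    refine (Runs.skip ?_).mono hT fun _ h => h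
    have hr : s₁.real r = s.real r := by
      rw [hs₁, Store.receive_real_of_ne _ _ (by omega) (by omega)]
    have hv : s₁.real (r + 2) = s.real (r + 2) := by
      rw [hs₁, Store.receive_real_of_ne _ _ (by omega) (by omega)]
    have h5 : s₁.nat 5 = s.nat 5 := by rw [hs₁, Store.receive_nat_of_ne _ _ _ (by norm_num)]
    refine ⟨hs.congr h5 hr hv, fun h => h.congr h5 hv, fun ⟨x, w, h, hw⟩ => ?_⟩
    have h3 : s₁.real (r + 3) 0 = w := by simp [hs₁, h, Store.receive]
    have h4 : s₁.nat 4 0 = 1 := by simp [hs₁, h, Store.receive]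
    simp only [BExp.holds, NExp.eval, RExp.eval, h4, le_refl, true_and, not_not, h3] at hb
    exact ⟨by omega, hw.trans hb.2⟩

/-- Query the oracle at all sets that consist of initial and final elements in the order given by
the permutation in the integer array `2`. -/
def searchSupports (r : ℕ) : Program :=
  .forLoop 6 (.add (var 0) (.const 1)) (.seq
    (.forLoop 7 (var 0) (.setNat 3 (.get 2 (var 7)) (.sub (var 6) (var 7))))
    (.forLoop 7 (.add (var 0) (.const 1)) (.seq (trySupport r)
      (.setNat 3 (.get 2 (.sub (.sub (var 0) (.const 1)) (var 7))) (.const 1)))))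

theorem natWrites_searchSupports (r : ℕ) :
    (searchSupports r).natWrites = {6, 7, 3, 4, 5} := by
  ext a
  simp only [searchSupports, trySupport, Program.natWrites_forLoop, Program.natWrites,
    Set.mem_union, Set.mem_singleton_iff, Set.mem_insert_iff, Set.mem_empty_iff_false]
  tauto

theorem realWrites_searchSupports (r : ℕ) :
    (searchSupports r).realWrites = {r, r + 1, r + 2, r + 3} := by
  ext a
  simp only [searchSupports, trySupport, Program.realWrites_forLoop, Program.realWrites,
    Set.mem_union, Set.mem_singleton_iff, Set.mem_insert_iff, Set.mem_empty_iff_false]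
  tauto

theorem Store.readSet_eq_endsSet {n : ℕ} {s : Store} {σ : Equiv.Perm (Fin n)} {b a c : ℕ}
    (h : ∀ j : Fin n, s.nat b (σ j) ≠ 0 ↔ (j : ℕ) < a ∨ n ≤ j + c) :
    s.readSet b n = endsSet σ a c := by
  ext j
  have := h (σ.symm j)
  rw [Equiv.apply_symm_apply] at this
  simp [Store.readSet, endsSet, ← this]

/-- For fixed `a` the indicator is built once in O(n); raising `c` by one then sets a single entry.
The overhead per query is constant and all pairs `(a, c)` cost O(n² T₁). -/
theorem runs_searchSupports {n : ℕ} {O : Oracles n} (hn : 1 ≤ n) (hT : 1 ≤ O.suppTime) (r : ℕ)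
    (z : ℝ) {σ : Equiv.Perm (Fin n)} {s : Store} (hs : s.nat 0 0 = n) (hσ : s.HoldsPerm 2 σ)
    (hinc : Incumbent O r s) :
    Runs O (searchSupports r) s (400 * (n ^ 2 * O.suppTime)) fun s' => Incumbent O r s' ∧
      (Reaches r z s → Reaches r z s') ∧
        ∀ a ≤ n, ∀ c ≤ n, AnswerGE O z (endsSet σ a c) → Reaches r z s' := by
  set T := O.suppTime with hTdef
  -- `2 * n` bounds the n + 1 passes. Per unit `n * T`, the constant 150 consists of 30 for
  -- initializing the indicator and 120 for the inner loop.
  have outer : Runs O (searchSupports r) s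
      ((150 + (2 * (NExp.add (var 0) (.const 1)).cost + 17)) * ((2 * n) * (n * T)))
      fun s' => (s'.nat 0 0 = n ∧ s'.HoldsPerm 2 σ ∧ Incumbent O r s') ∧
        (Reaches r z s → Reaches r z s') ∧
        ∀ a < n + 1, (∃ c ≤ n, AnswerGE O z (endsSet σ a c)) → Reaches r z s' := by
    refine Runs.forLoop_hit (by omega) (by omega) (Nat.mul_pos hn hT)
      (by simp [Program.natWrites, Program.natWrites_forLoop, trySupport])
      (fun s k h => ⟨by simp [Store.writeNat, h.1],
        h.2.1.congr (Store.writeNat_nat_of_ne _ (by norm_num) _ _), h.2.2.writeNat (by norm_num) _ _⟩)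
      (fun s k h => h.writeNat (by norm_num) _ _) ⟨hs, hσ, hinc⟩
      (fun s h => by simp [NExp.eval, h.1]) ?_
    intro a s₁ ha ha₁ ⟨hn₁, hσ₁, hinc₁⟩
    have init : Runs O (.forLoop 7 (var 0) (.setNat 3 (.get 2 (var 7)) (.sub (var 6) (var 7)))) s₁
        ((9 + (2 * (var 0).cost + 17)) * (n * 1)) fun s' =>
          s'.nat 0 0 = n ∧ s'.nat 6 0 = a ∧ s'.HoldsPerm 2 σ ∧ Incumbent O r s' ∧
          (Reaches r z s₁ → Reaches r z s') ∧
          -- Truncated subtraction serves as the indicator: `a - j` is nonzero exactly when j < a.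
          ∀ j : Fin n, (j : ℕ) < n → s'.nat 3 (σ j) = a - j := by
      refine Runs.forLoop (I := fun i s' =>
          s'.nat 0 0 = n ∧ s'.nat 6 0 = a ∧ s'.HoldsPerm 2 σ ∧ Incumbent O r s' ∧
          (Reaches r z s₁ → Reaches r z s') ∧
          ∀ j : Fin n, (j : ℕ) < i → s'.nat 3 (σ j) = a - j)
        le_rfl hn le_rfl (by simp [Program.natWrites]) ?_ (fun k s h => h.1) ?_
      · exact ⟨by simp [Store.writeNat, hn₁], by simp [Store.writeNat, ha₁],
          hσ₁.congr (Store.writeNat_nat_of_ne _ (by norm_num) _ _), hinc₁.writeNat (by norm_num) _ _,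
          fun h => h.writeNat (by norm_num) _ _, by simp⟩
      · intro i s₂ hi hi₂ ⟨hn₂, ha₂, hσ₂, hinc₂, hD₂, h3₂⟩
        obtain ⟨x, rfl⟩ : ∃ x : Fin n, (x : ℕ) = i := ⟨⟨i, hi⟩, rfl⟩
        refine (Runs.setNat ?_).mono (by simp [NExp.cost]) fun _ h => h
        simp only [NExp.eval, hi₂, ha₂, hσ₂ x]
        refine ⟨by simp [Store.writeNat, hn₂], by simp [Store.writeNat, ha₂],
          (hσ₂.congr (Store.writeNat_nat_of_ne _ (by norm_num) _ _)).congr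
            (Store.writeNat_nat_of_ne _ (by norm_num) _ _),
          (hinc₂.writeNat (by norm_num) _ _).writeNat (by norm_num) _ _,
          fun h => ((hD₂ h).writeNat (by norm_num) _ _).writeNat (by norm_num) _ _,
          fun j hj => ?_⟩
        rw [Store.writeNat_nat_of_ne _ (by norm_num)]
        rcases Nat.lt_succ_iff_lt_or_eq.mp hj with hj | hj
        · rw [Store.writeNat_nat_of_index_ne, h3₂ j hj]
          intro heq
          have := σ.injective (Fin.ext heq)
          exact hj.ne (congrArg Fin.val this)
        · obtain rfl := Fin.ext hj
          simp
    refine (Runs.seq init fun s₂ h₂ => Runs.mono (B := (35 + (2 *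
      (NExp.add (var 0) (.const 1)).cost + 17)) * ((2 * n) * T))
      (Q := fun s' => s'.nat 0 0 = n ∧ s'.HoldsPerm 2 σ ∧ Incumbent O r s' ∧
        (Reaches r z s₁ → Reaches r z s') ∧
        (∀ j : Fin n, s'.nat 3 (σ j) ≠ 0 ↔ (j : ℕ) < a ∨ n ≤ j + (n + 1)) ∧
        ∀ c < n + 1, AnswerGE O z (endsSet σ a c) → Reaches r z s')
      (Runs.forLoop (I := fun k s' => s'.nat 0 0 = n ∧ s'.HoldsPerm 2 σ ∧ Incumbent O r s' ∧
        (Reaches r z s₁ → Reaches r z s') ∧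
        (∀ j : Fin n, s'.nat 3 (σ j) ≠ 0 ↔ (j : ℕ) < a ∨ n ≤ j + k) ∧
        ∀ c < k, AnswerGE O z (endsSet σ a c) → Reaches r z s')
        (by omega) (by omega) hT (by simp [Program.natWrites, trySupport]) ?_
        (fun k s h => by simp [NExp.eval, h.1]) ?_) le_rfl
        (fun s₃ h => (⟨⟨h.1, h.2.1, h.2.2.1⟩, h.2.2.2.1, fun ⟨c, hc, hans⟩ =>
          h.2.2.2.2.2 c (by omega) hans⟩ : _ ∧ _ ∧ _))).mono ?_ fun _ h => h
    · obtain ⟨hn₂, ha₂, hσ₂, hinc₂, hD₂, h3₂⟩ := h₂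
      refine ⟨by simp [Store.writeNat, hn₂],
        hσ₂.congr (Store.writeNat_nat_of_ne _ (by norm_num) _ _),
        hinc₂.writeNat (by norm_num) _ _, fun h => (hD₂ h).writeNat (by norm_num) _ _,
        fun j => ?_, by simp⟩
      rw [Store.writeNat_nat_of_ne _ (by norm_num), h3₂ j j.2]
      omega
    · intro c s₃ hc hc₃ ⟨hn₃, hσ₃, hinc₃, hD₃, h3₃, hans₃⟩
      refine (Runs.seq (runs_trySupport hT r z hinc₃).frame fun s₄ h₄ =>
        Runs.setNat ?_).mono (by simp only [NExp.cost]; omega) fun _ h => h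
      obtain ⟨⟨hinc₄, hD₄, hans₄⟩, hnat, -⟩ := h₄
      have hnat' : ∀ b, b ≠ 4 → b ≠ 5 → s₄.nat b = s₃.nat b := fun b h h' =>
        hnat b (by simp [trySupport, Program.natWrites, h, h'])
      rw [Store.readSet_eq_endsSet h3₃] at hans₄
      have h0 := hnat' 0 (by norm_num) (by norm_num)
      have h2 := hnat' 2 (by norm_num) (by norm_num)
      have h3 := hnat' 3 (by norm_num) (by norm_num)
      have h7 := hnat' 7 (by norm_num) (by norm_num)
      -- In the last pass c = n and the index truncates to 0; this write comes after the last query,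
      -- when the set is already full, so it is harmless.
      have hidx : s₃.nat 2 (n - 1 - c) = σ ⟨n - 1 - c, by omega⟩ := hσ₃ ⟨n - 1 - c, by omega⟩
      simp only [NExp.eval, h0, h2, h7, hn₃, hc₃, hidx]
      refine ⟨by simp [Store.writeNat, h0, hn₃],
        ((hσ₃.congr h2).congr (Store.writeNat_nat_of_ne _ (by norm_num) _ _)).congr
          (Store.writeNat_nat_of_ne _ (by norm_num) _ _),
        (hinc₄.writeNat (by norm_num) _ _).writeNat (by norm_num) _ _,
        fun h => ((hD₄ (hD₃ h)).writeNat (by norm_num) _ _).writeNat (by norm_num) _ _,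
        fun j => ?_, fun c' hc' hhit => ?_⟩
      · rw [Store.writeNat_nat_of_ne _ (by norm_num)]
        by_cases hj : j = ⟨n - 1 - c, by omega⟩
        · subst hj
          simp only [Store.writeNat_nat_self]
          omega
        · rw [Store.writeNat_nat_of_index_ne, h3, h3₃ j]
          · have : (j : ℕ) ≠ n - 1 - c := fun h => hj (Fin.ext h)
            omega
          · intro heq
            exact hj (σ.injective (Fin.ext heq))
      · refine Reaches.writeNat (Reaches.writeNat ?_ (by norm_num) _ _) (by norm_num) _ _
        rcases Nat.lt_succ_iff_lt_or_eq.mp hc' with hc' | rfl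
        · exact hD₄ (hans₃ c' hc' hhit)
        · exact hans₄ hhit
    · simp only [NExp.cost]
      have h1 : n ≤ n * T := Nat.le_mul_of_pos_right n hT
      rw [mul_one, mul_assoc 2]
      omega
  refine outer.mono ?_ fun s' h => ⟨h.1.2.2, h.2.1, fun a ha c hc hans =>
    h.2.2 a (by omega) ⟨c, hc, hans⟩⟩
  simp only [NExp.cost]
  have : 2 * n * (n * T) = 2 * (n ^ 2 * T) := by ring
  rw [this]
  omega

/-- Sort by the keys, apply the permutation mapping and search the resulting supports. -/
def processKeys (r : ℕ) (ks : List ℕ) : Program :=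
  .seq (sortKeys ks) (.seq (.askPerm 1 2) (searchSupports r))

theorem natWrites_processKeys (r : ℕ) (ks : List ℕ) :
    (processKeys r ks).natWrites ⊆ Set.Icc 1 8 := by
  intro a
  simp only [processKeys, Program.natWrites, natWrites_sortKeys, natWrites_searchSupports,
    Set.mem_union, Set.mem_singleton_iff, Set.mem_insert_iff, Set.mem_Icc]
  omega

theorem realWrites_processKeys (r : ℕ) (ks : List ℕ) :
    (processKeys r ks).realWrites ⊆ Set.Icc r (r + 3) := by
  intro a
  simp only [processKeys, Program.realWrites, realWrites_sortKeys, realWrites_searchSupports,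
    Set.mem_union, Set.mem_singleton_iff, Set.mem_insert_iff, Set.mem_Icc,
    Set.mem_empty_iff_false, false_or]
  intro h
  omega

/-- Some solution whose support is considered for the keys `K` has value at least `z`. -/
def Hits {n : ℕ} (O : Oracles n) (z : ℝ) (K : List (Fin n → ℝ)) : Prop :=
  ∃ a ≤ n, ∃ c ≤ n, AnswerGE O z (endsSet (O.perm (lexPerm K)) a c)

theorem runs_processKeys (r : ℕ) (ks : List ℕ) : ∃ C : ℕ, ∀ (n : ℕ) (O : Oracles n) (z : ℝ)
    (s : Store), 1 ≤ n → 1 ≤ O.suppTime → s.nat 0 0 = n → Incumbent O r s →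
      Runs O (processKeys r ks) s (C * (n ^ 2 * O.suppTime + O.permTime)) fun s' =>
        Incumbent O r s' ∧ (Reaches r z s → Reaches r z s') ∧
          (Hits O z (s.readVecs ks n) → Reaches r z s') := by
  obtain ⟨C, hC⟩ := runs_sortKeys ks
  refine ⟨C + 401, fun n O z s hn hT hs hinc => ?_⟩
  refine (Runs.seq (hC n O s hn hs).frame fun s₁ ⟨hπ, hnat, hreal⟩ =>
    Runs.seq (Runs.askPerm (Q := fun s₂ => s₂ = s₁.writePerm 2 (O.perm (lexPerm (s.readVecs ks n))))
      hπ rfl) fun s₂ hs₂ => (runs_searchSupports hn hT r z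
        (σ := O.perm (lexPerm (s.readVecs ks n))) ?_ ?_ ?_).mono
        le_rfl ?_).mono ?_ fun _ h => h
  · rw [hs₂, Store.writePerm_nat_of_ne _ (by norm_num), hnat 0 (by simp [natWrites_sortKeys]), hs]
  · rw [hs₂]
    exact Store.holdsPerm_writePerm _ _ _
  · refine hinc.congr ?_ ?_ ?_
    · rw [hs₂, Store.writePerm_nat_of_ne _ (by norm_num), hnat 5 (by simp [natWrites_sortKeys])]
    · rw [hs₂]
      exact hreal _ (by simp [realWrites_sortKeys])
    · rw [hs₂]
      exact hreal _ (by simp [realWrites_sortKeys])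
  · rintro s₃ ⟨hinc₃, hD₃, hans₃⟩
    refine ⟨hinc₃, fun h => hD₃ (h.congr ?_ ?_), fun ⟨a, ha, c, hc, h⟩ => hans₃ a ha c hc h⟩
    · rw [hs₂, Store.writePerm_nat_of_ne _ (by norm_num), hnat 5 (by simp [natWrites_sortKeys])]
    · rw [hs₂]
      exact hreal _ (by simp [realWrites_sortKeys])
  · have h1 : C * n ^ 2 ≤ C * (n ^ 2 * O.suppTime) :=
      Nat.mul_le_mul_left _ (Nat.le_mul_of_pos_right _ hT)
    calc C * n ^ 2 + (O.permTime + 400 * (n ^ 2 * O.suppTime))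
        ≤ C * (n ^ 2 * O.suppTime) + (O.permTime + 400 * (n ^ 2 * O.suppTime))
            + (C + 400) * O.permTime + n ^ 2 * O.suppTime := by
          omega
      _ = (C + 401) * (n ^ 2 * O.suppTime + O.permTime) := by ring

/-! ## Enumerating the elimination paths -/

/-- Fill the real array `d` with the values of `e`, in which variable `6` is the index. -/
def fillArray (d : ℕ) (e : RExp) : Program :=
  .forLoop 6 (var 0) (.setReal d (var 6) e)

theorem natWrites_fillArray (d : ℕ) (e : RExp) : (fillArray d e).natWrites = {6} := by
  simp [fillArray, Program.natWrites_forLoop, Program.natWrites]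

theorem realWrites_fillArray (d : ℕ) (e : RExp) : (fillArray d e).realWrites = {d} := by
  simp [fillArray, Program.realWrites_forLoop, Program.realWrites]

/-- The value of `e` is required in every store that agrees with `s` outside the counter and the
target, so `e` may be evaluated while the target is partly overwritten. -/
theorem runs_fillArray (hn : 1 ≤ n) {d : ℕ} {e : RExp} {x : Fin n → ℝ} {s : Store}
    (hs : s.nat 0 0 = n) (he : ∀ (j : Fin n) (s' : Store), (∀ a, a ≠ 6 → s'.nat a = s.nat a) →
      (∀ a, a ≠ d → s'.real a = s.real a) → s'.nat 6 0 = j → e.eval s' = x j) :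
    Runs O (fillArray d e) s ((e.cost + 24) * n) fun s' => s'.readVec d n = x := by
  have : Runs O (fillArray d e) s ((e.cost + 3 + (2 * (var 0).cost + 17)) * (n * 1)) fun s' =>
      (∀ a, a ≠ 6 → s'.nat a = s.nat a) ∧ (∀ a, a ≠ d → s'.real a = s.real a) ∧
        ∀ j : Fin n, (j : ℕ) < n → s'.real d j = x j := by
    refine Runs.forLoop (I := fun k s' => (∀ a, a ≠ 6 → s'.nat a = s.nat a) ∧
      (∀ a, a ≠ d → s'.real a = s.real a) ∧ ∀ j : Fin n, (j : ℕ) < k → s'.real d j = x j)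
      le_rfl hn le_rfl (by simp [Program.natWrites])
      ⟨fun a ha => Store.writeNat_nat_of_ne _ ha _ _, fun _ _ => rfl, by simp⟩
      (fun k s' h => by simp [NExp.eval, h.1, hs]) ?_
    intro k s' hk hk' ⟨h1, h2, h3⟩
    obtain ⟨j, rfl⟩ : ∃ j : Fin n, (j : ℕ) = k := ⟨⟨k, hk⟩, rfl⟩
    refine (Runs.setReal ?_).mono (by simp only [NExp.cost]; omega) fun _ h => h
    rw [he j s' h1 h2 hk']
    simp only [NExp.eval, hk']
    refine ⟨fun a ha => ?_, fun a ha => ?_, fun i hi => ?_⟩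
    · rw [Store.writeNat_nat_of_ne _ ha, Store.writeReal_nat, h1 a ha]
    · rw [Store.writeNat_real, Store.writeReal_real_of_ne _ ha, h2 a ha]
    · rw [Store.writeNat_real]
      rcases Nat.lt_succ_iff_lt_or_eq.mp hi with hi | hi
      · rw [Store.writeReal_real_of_index_ne _ _ hi.ne, h3 i hi]
      · obtain rfl := Fin.ext hi
        simp
  exact this.mono (by simp only [NExp.cost, mul_one]; exact Nat.mul_le_mul_right n (by omega)) fun s' h => funext fun j => h.2.2 j j.2

/-- The entry of the scaled pivot, where `i` and `j` are variables. -/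
def pivotExp (b i j : ℕ) : RExp :=
  .div (.get b (var 6)) (.sub (.get b (var i)) (.get b (var j)))

/-- The entry of the array `a` after the elimination with the pivot `b`. -/
def elimExp (b i j a : ℕ) : RExp :=
  .sub (.get a (var 6)) (.mul (.sub (.get a (var i)) (.get a (var j))) (pivotExp b i j))

/-- Eliminate with the pivot `b` in the arrays of the list and store the results, followed by the
scaled pivot, in the arrays from `d` on. -/
def eliminate (b i j : ℕ) : List ℕ → ℕ → Program
  | [], d => fillArray d (pivotExp b i j)
  | a :: l, d => .seq (fillArray d (elimExp b i j a)) (eliminate b i j l (d + 1))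

theorem natWrites_eliminate (b i j : ℕ) (l : List ℕ) (d : ℕ) :
    (eliminate b i j l d).natWrites = {6} := by
  induction l generalizing d with
  | nil => exact natWrites_fillArray _ _
  | cons a l ih => simp [eliminate, Program.natWrites, ih, natWrites_fillArray]

theorem realWrites_eliminate (b i j : ℕ) (l : List ℕ) (d : ℕ) :
    (eliminate b i j l d).realWrites ⊆ Set.Ici d := by
  induction l generalizing d with
  | nil => simp [eliminate, realWrites_fillArray]
  | cons a l ih =>
    simp only [eliminate, Program.realWrites, realWrites_fillArray]
    refine Set.union_subset (by simp) ((ih (d + 1)).trans ?_)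
    exact Set.Ici_subset_Ici.mpr (Nat.le_succ d)

/-- All inputs have names below `d`, so no write destroys a row still needed. The machine's quotient
by 0 is 0, as in `pivot`, so degenerate pairs need no test. -/
theorem runs_eliminate (hn : 1 ≤ n) {b i j : ℕ} (hi : i ≠ 6) (hj : j ≠ 6) (x y : Fin n)
    (l : List ℕ) (d : ℕ) (hl : ∀ a ∈ l, a < d) (hb : b < d) (s : Store) (hs : s.nat 0 0 = n)
    (hx : s.nat i 0 = x) (hy : s.nat j 0 = y) :
    Runs O (eliminate b i j l d) s (50 * (l.length + 1) * n) fun s' =>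
      s'.readVecs (List.range' d l.length) n =
          (s.readVecs l n).map (elim (s.readVec b n) x y) ∧
        s'.readVec (d + l.length) n = pivot (s.readVec b n) x y := by
  induction l generalizing d s with
  | nil =>
    refine (runs_fillArray (x := pivot (s.readVec b n) x y) hn hs fun k s' h1 h2 h6 => ?_).mono
      ?_ fun s' h => ⟨rfl, h⟩
    · simp only [pivotExp, RExp.eval, NExp.eval, h6, h1 i hi, h1 j hj, h2 b hb.ne, hx, hy]
      rfl
    · refine Nat.mul_le_mul_right n ?_
      simp [pivotExp, RExp.cost, NExp.cost]
  | cons a l ih =>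
    have ha : a < d := hl a (by simp)
    refine (Runs.seq (runs_fillArray (x := elim (s.readVec b n) x y (s.readVec a n)) hn hs
      fun k s' h1 h2 h6 => ?_).frame fun s₁ ⟨hd, hnat, hreal⟩ =>
        (ih (d + 1) (fun a ha => (hl a (by simp [ha])).trans (Nat.lt_succ_self d))
          (hb.trans (Nat.lt_succ_self d)) s₁ ?_ ?_ ?_).frame.mono le_rfl ?_).mono ?_ fun _ h => h
    · simp only [elimExp, pivotExp, RExp.eval, NExp.eval, h6, h1 i hi, h1 j hj, h2 b hb.ne,
        h2 a ha.ne, hx, hy]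
      rfl
    · have : (elimExp b i j a).cost + 24 ≤ 50 := by
        simp [elimExp, pivotExp, RExp.cost, NExp.cost]
      have := Nat.mul_le_mul_right n this
      rw [List.length_cons]
      linarith
    · rw [hnat 0 (by simp [natWrites_fillArray]), hs]
    · rw [hnat i (by simpa [natWrites_fillArray] using hi), hx]
    · rw [hnat j (by simpa [natWrites_fillArray] using hj), hy]
    · rintro s₂ ⟨⟨h1, h2⟩, -, hreal₂⟩
      have hreal' : ∀ c, c < d → s₁.real c = s.real c := fun c hc =>
        hreal c (by simpa [realWrites_fillArray] using hc.ne)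
      have hd₂ : s₂.real d = s₁.real d := hreal₂ d fun hmem => by
        have := realWrites_eliminate _ _ _ _ _ hmem
        simp at this
      rw [Store.readVec_congr n (hreal' b hb)] at h1 h2
      rw [Store.readVecs_congr n fun c hc => hreal' c (hl c (by simp [hc]))] at h1
      constructor
      · simp only [List.length_cons, List.range'_succ, Store.readVecs, List.map_cons]
        rw [Store.readVec_congr n hd₂, hd]
        exact congrArg _ h1
      · rw [← h2, List.length_cons]
        congr 1
        omega

/-- Process the keys of all elimination paths for the `m + 1` arrays `rows`, starting with the keys
`ks`. Integer and real arrays from `q` on are used as working memory. -/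
def enumerate (r : ℕ) : ℕ → List ℕ → List ℕ → ℕ → Program
  | 0, rows, ks, q => .seq (processKeys r (rows.headD 0 :: ks))
      (.seq (fillArray q (.sub (.const 0) (.get (rows.headD 0) (var 6))))
        (processKeys r (q :: ks)))
  | m + 1, rows, ks, q => .seqAll ((List.range (m + 2)).map fun k =>
      .forLoop q (var 0) (.forLoop (q + 1) (var 0)
        (.seq (eliminate (rows.getD k 0) q (q + 1) (rows.eraseIdx k) q)
          (enumerate r m (List.range' q (m + 1)) ((q + (m + 1)) :: ks) (q + (m + 2))))))

theorem natWrites_seqAll_subset {l : List Program} {S : Set ℕ} (h : ∀ p ∈ l, p.natWrites ⊆ S) :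
    (Program.seqAll l).natWrites ⊆ S := by
  induction l with
  | nil => exact Set.empty_subset _
  | cons p l ih =>
    exact Set.union_subset (h p (by simp)) (ih fun p hp => h p (by simp [hp]))

theorem realWrites_seqAll_subset {l : List Program} {S : Set ℕ}
    (h : ∀ p ∈ l, p.realWrites ⊆ S) : (Program.seqAll l).realWrites ⊆ S := by
  induction l with
  | nil => exact Set.empty_subset _
  | cons p l ih =>
    exact Set.union_subset (h p (by simp)) (ih fun p hp => h p (by simp [hp]))

theorem natWrites_enumerate (r m : ℕ) (rows ks : List ℕ) (q : ℕ) :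
    (enumerate r m rows ks q).natWrites ⊆ Set.Icc 1 8 ∪ Set.Ici q := by
  induction m generalizing rows ks q with
  | zero =>
    refine Set.union_subset ((natWrites_processKeys _ _).trans Set.subset_union_left)
      (Set.union_subset ?_ ((natWrites_processKeys _ _).trans Set.subset_union_left))
    simp [natWrites_fillArray]
  | succ m ih =>
    refine natWrites_seqAll_subset fun p hp => ?_
    obtain ⟨k, -, rfl⟩ := List.mem_map.mp hp
    simp only [Program.natWrites_forLoop, Program.natWrites, natWrites_eliminate]
    refine Set.union_subset (by simp) (Set.union_subset (by simp) (Set.union_subset (by simp)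
      ((ih _ _ _).trans (Set.union_subset_union_right _ (Set.Ici_subset_Ici.mpr (by omega))))))

theorem realWrites_enumerate (r m : ℕ) (rows ks : List ℕ) (q : ℕ) :
    (enumerate r m rows ks q).realWrites ⊆ Set.Icc r (r + 3) ∪ Set.Ici q := by
  induction m generalizing rows ks q with
  | zero =>
    refine Set.union_subset ((realWrites_processKeys _ _).trans Set.subset_union_left)
      (Set.union_subset ?_ ((realWrites_processKeys _ _).trans Set.subset_union_left))
    simp [realWrites_fillArray]
  | succ m ih =>
    refine realWrites_seqAll_subset fun p hp => ?_
    obtain ⟨k, -, rfl⟩ := List.mem_map.mp hp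
    simp only [Program.realWrites_forLoop, Program.realWrites]
    exact Set.union_subset ((realWrites_eliminate _ _ _ _ _).trans Set.subset_union_right)
      ((ih _ _ _).trans (Set.union_subset_union_right _ (Set.Ici_subset_Ici.mpr (by omega))))

/-- The specification of `enumerate`: the value `z` is reached if some elimination path hits it. -/
def EnumerateSpec (O : Oracles n) (r : ℕ) (z : ℝ) (rows ks : List ℕ) (s s' : Store) : Prop :=
  Incumbent O r s' ∧ (Reaches r z s → Reaches r z s') ∧
    ∀ K, Candidate (s.readVecs rows n) (s.readVecs ks n) K → Hits O z K → Reaches r z s'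

/-- The two leaves of a path are the remaining row and its negative, which is built in the free
array `q`. The condition on names keeps rows and keys apart from the arrays that the search
overwrites. -/
theorem runs_enumerate_zero (r : ℕ) (rows ks : List ℕ) (q : ℕ) (hlen : rows.length = 1)
    (hr : r + 4 ≤ q) (hnames : ∀ a ∈ rows ++ ks, a < q ∧ (a < r ∨ r + 4 ≤ a)) :
    ∃ C : ℕ, ∀ (n : ℕ) (O : Oracles n) (z : ℝ) (s : Store), 1 ≤ n → 1 ≤ O.suppTime →
      s.nat 0 0 = n → Incumbent O r s →
        Runs O (enumerate r 0 rows ks q) s (C * (n ^ 2 * O.suppTime + O.permTime))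
          (EnumerateSpec O r z rows ks s) := by
  obtain ⟨a, rfl⟩ := List.length_eq_one_iff.mp hlen
  obtain ⟨C₁, hC₁⟩ := runs_processKeys r (a :: ks)
  obtain ⟨C₂, hC₂⟩ := runs_processKeys r (q :: ks)
  refine ⟨C₁ + 30 + C₂, fun n O z s hn hT hs hinc => ?_⟩
  have ha := hnames a (by simp)
  refine (Runs.seq (hC₁ n O z s hn hT hs hinc).frame fun s₁ ⟨⟨hinc₁, hD₁, hhit₁⟩, hnat₁, hreal₁⟩ =>
    Runs.seq (runs_fillArray (x := -(s.readVec a n)) hn ?_ fun j s' h1 h2 h6 => ?_).frame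
      fun s₂ ⟨hq, hnat₂, hreal₂⟩ =>
    (hC₂ n O z s₂ hn hT ?_ ?_).mono le_rfl ?_).mono ?_ fun _ h => h
  · rw [hnat₁ 0 fun h => by simpa using natWrites_processKeys _ _ h, hs]
  · have : s₁.real a = s.real a := hreal₁ a fun h => by
      have := realWrites_processKeys _ _ h
      rw [Set.mem_Icc] at this
      omega
    simp only [RExp.eval, NExp.eval, List.headD_cons, h6, h2 a (by omega), this, Int.cast_zero,
      zero_sub]
    rfl
  · set W := n ^ 2 * O.suppTime + O.permTime
    have hW : n ≤ W := by
      have h1 : n ≤ n ^ 2 := Nat.le_self_pow (by norm_num) n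
      have h2 : n ^ 2 ≤ n ^ 2 * O.suppTime := Nat.le_mul_of_pos_right _ hT
      omega
    have hcost : ((RExp.const 0).sub (.get ([a].headD 0) (var 6))).cost + 24 ≤ 30 := by
      simp [RExp.cost, NExp.cost]
    have := Nat.mul_le_mul hcost hW
    linarith
  · rw [hnat₂ 0 (by simp [natWrites_fillArray]),
      hnat₁ 0 fun h => by simpa using natWrites_processKeys _ _ h, hs]
  · refine hinc₁.congr (hnat₂ 5 (by simp [natWrites_fillArray])) (hreal₂ r ?_)
      (hreal₂ (r + 2) ?_) <;> simp only [realWrites_fillArray, Set.mem_singleton_iff] <;> omega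
  · rintro s₃ ⟨hinc₃, hD₃, hhit₃⟩
    have hD : Reaches r z s₁ → Reaches r z s₃ := fun h => hD₃ (h.congr
      (hnat₂ 5 (by simp [natWrites_fillArray])) (hreal₂ (r + 2) (by
        simp only [realWrites_fillArray, Set.mem_singleton_iff]
        omega)))
    refine ⟨hinc₃, fun h => hD (hD₁ h), fun K hK hits => ?_⟩
    have hks : s₂.readVecs ks n = s.readVecs ks n := Store.readVecs_congr n fun c hc => by
      have hc := hnames c (by simp [hc])
      rw [hreal₂ c (by simp only [realWrites_fillArray, Set.mem_singleton_iff]; omega),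
        hreal₁ c fun h => by
          have := realWrites_processKeys _ _ h
          rw [Set.mem_Icc] at this
          omega]
    cases hK with
    | base => exact hD (hhit₁ hits)
    | baseNeg =>
      refine hhit₃ ?_
      change Hits O z (s₂.readVec q n :: s₂.readVecs ks n)
      rw [hq, hks]
      exact hits
    | step _ _ h2 => simp [Store.readVecs] at h2

/-- Each level owns the integer counters q and q + 1 and the real arrays q to q + m + 1 (new rows,
then the pivot), and passes q + m + 2 on to the next level; deeper levels hence leave the data of
the outer ones intact. The bound 9 ≤ q separates the counters from the fixed integer arrays. -/
theorem runs_enumerate (r m : ℕ) (rows ks : List ℕ) (q : ℕ) (hlen : rows.length = m + 1)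
    (hr : r + 4 ≤ q) (hq : 9 ≤ q) (hnames : ∀ a ∈ rows ++ ks, a < q ∧ (a < r ∨ r + 4 ≤ a)) :
    ∃ C : ℕ, ∀ (n : ℕ) (O : Oracles n) (z : ℝ) (s : Store), 1 ≤ n → 1 ≤ O.suppTime →
      s.nat 0 0 = n → Incumbent O r s →
        Runs O (enumerate r m rows ks q) s
          (C * (n ^ (2 * m) * (n ^ 2 * O.suppTime + O.permTime)))
          (EnumerateSpec O r z rows ks s) := by
  induction m generalizing rows ks q with
  | zero => simpa using runs_enumerate_zero r rows ks q hlen hr hnames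
  | succ m ih =>
    obtain ⟨C, hC⟩ := ih (List.range' q (m + 1)) ((q + (m + 1)) :: ks) (q + (m + 2)) (by simp)
      (by omega) (by omega) (by
        intro a ha
        simp only [List.mem_append, List.mem_range'_1, List.mem_cons] at ha
        rcases ha with ha | rfl | ha
        · omega
        · omega
        · have := hnames a (by simp [ha])
          omega)
    -- For each pivot row: the elimination, the recursive call, and 21 for the control of each of
    -- the two loops over i and j; the final 1 pays for the closing `skip`.
    refine ⟨((List.range (m + 2)).map fun _ => 50 * (m + 2) + C + 21 + 21).sum + 1,
      fun n O z s hn hT hs hinc => ?_⟩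
    set V := n ^ (2 * m) * (n ^ 2 * O.suppTime + O.permTime) with hV
    -- The O(n) cost of an elimination is absorbed by the recursive call that follows it.
    have hnV : n ≤ V := by
      have h1 : n ≤ n ^ 2 := Nat.le_self_pow (by norm_num) n
      have h2 : n ^ 2 ≤ n ^ 2 * O.suppTime := Nat.le_mul_of_pos_right _ hT
      exact (by omega : n ≤ n ^ 2 * O.suppTime + O.permTime).trans
        (Nat.le_mul_of_pos_left _ (Nat.pow_pos hn))
    have hV1 : 1 ≤ V := hn.trans hnV
    set R := s.readVecs rows n with hR
    set K₀ := s.readVecs ks n with hK₀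
    have hRlen : R.length = m + 2 := by simp [hR, Store.readVecs, hlen]
    let J : Store → Prop := fun s' => s'.nat 0 0 = n ∧ s'.readVecs rows n = R ∧
      s'.readVecs ks n = K₀ ∧ Incumbent O r s'
    have hJw : ∀ (s' : Store) (c i : ℕ), 9 ≤ c → J s' → J (s'.writeNat c 0 i) :=
      fun s' c i hc h => ⟨by rw [Store.writeNat_nat_of_ne _ (by omega), h.1], h.2.1, h.2.2.1,
        h.2.2.2.writeNat (by omega) _ _⟩
    let hit : ℕ → Fin n → Fin n → Prop := fun k i j => ∃ b, R[k]? = some b ∧ ∃ K,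
      Candidate ((R.eraseIdx k).map (elim b i j)) (pivot b i j :: K₀) K ∧ Hits O z K
    have body : ∀ k < m + 2, ∀ i j : Fin n, ∀ s₁ : Store, J s₁ → s₁.nat q 0 = i →
        s₁.nat (q + 1) 0 = j →
        Runs O (.seq (eliminate (rows.getD k 0) q (q + 1) (rows.eraseIdx k) q)
          (enumerate r m (List.range' q (m + 1)) ((q + (m + 1)) :: ks) (q + (m + 2)))) s₁
          ((50 * (m + 2) + C) * V) fun s' =>
            J s' ∧ (Reaches r z s₁ → Reaches r z s') ∧ (hit k i j → Reaches r z s') := by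
      intro k hk i j s₁ ⟨hn₁, hR₁, hK₁, hinc₁⟩ hi hj
      have hb : rows.getD k 0 = rows[k]'(by omega) := List.getD_eq_getElem _ _ _
      have hblt := (hnames (rows.getD k 0)
        (by rw [hb]; exact List.mem_append_left _ (List.getElem_mem _))).1
      have hel : (rows.eraseIdx k).length = m + 1 := by
        rw [List.length_eraseIdx_of_lt (by omega), hlen]
        rfl
      refine (Runs.seq (runs_eliminate hn (by omega) (by omega) i j (rows.eraseIdx k) q
        (fun a ha => (hnames a (List.mem_append_left _ (List.mem_of_mem_eraseIdx ha))).1) hblt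
        s₁ hn₁ hi hj).frame fun s₂ ⟨⟨he, hp⟩, hnat₂, hreal₂⟩ =>
          (hC n O z s₂ hn hT ?_ ?_).frame.mono le_rfl ?_).mono ?_ fun _ h => h
      · rw [hnat₂ 0 (by simp [natWrites_eliminate]), hn₁]
      · refine hinc₁.congr (hnat₂ 5 (by simp [natWrites_eliminate])) (hreal₂ r fun h => ?_)
          (hreal₂ (r + 2) fun h => ?_) <;>
        · have := realWrites_eliminate _ _ _ _ _ h
          rw [Set.mem_Ici] at this
          omega
      · rintro s₃ ⟨⟨hinc₃, hD₃, hhit₃⟩, hnat₃, hreal₃⟩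
        have hreal₂' : ∀ c, c < q → s₂.real c = s₁.real c := fun c hc => hreal₂ c fun h => by
          have := realWrites_eliminate _ _ _ _ _ h
          rw [Set.mem_Ici] at this
          omega
        have hreal : ∀ c ∈ rows ++ ks, s₃.real c = s₁.real c := fun c hc => by
          have hc := hnames c hc
          rw [hreal₃ c fun h => ?_, hreal₂' c hc.1]
          have := realWrites_enumerate _ _ _ _ _ h
          rw [Set.mem_union, Set.mem_Icc, Set.mem_Ici] at this
          omega
        refine ⟨⟨?_, ?_, ?_, hinc₃⟩, fun h => hD₃ (h.congr (hnat₂ 5 (by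
          simp [natWrites_eliminate])) (hreal₂' (r + 2) (by omega))), ?_⟩
        · rw [hnat₃ 0 fun h => ?_, hnat₂ 0 (by simp [natWrites_eliminate]), hn₁]
          have := natWrites_enumerate _ _ _ _ _ h
          rw [Set.mem_union, Set.mem_Icc, Set.mem_Ici] at this
          omega
        · rw [Store.readVecs_congr n fun c hc => hreal c (by simp [hc]), hR₁]
        · rw [Store.readVecs_congr n fun c hc => hreal c (by simp [hc]), hK₁]
        · rintro ⟨b, hRb, K, hK, hits⟩
          refine hhit₃ K ?_ hits
          have hb' : s₁.readVec (rows.getD k 0) n = b := by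
            rw [← hR₁, Store.readVecs, List.getElem?_map, List.getElem?_eq_getElem (by omega)]
              at hRb
            rw [hb]
            exact Option.some.inj hRb
          have her : s₁.readVecs (rows.eraseIdx k) n = R.eraseIdx k := by
            rw [← hR₁, Store.readVecs, Store.readVecs, List.eraseIdx_map]
          have hks : s₂.readVecs ks n = K₀ := by
            rw [Store.readVecs_congr n fun c hc => hreal₂' c (hnames c (by simp [hc])).1, hK₁]
          rw [hel, hb'] at he hp
          rw [her] at he
          change Candidate _ (s₂.readVec (q + (m + 1)) n :: s₂.readVecs ks n) K
          rw [he, hp, hks]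
          exact hK
      · rw [hel, ← hV, add_mul]
        exact Nat.add_le_add_right (Nat.mul_le_mul_left _ hnV) _
    have hcounter : ∀ k c, c = q ∨ c = q + 1 → c ∉ (Program.seq
        (eliminate (rows.getD k 0) q (q + 1) (rows.eraseIdx k) q)
          (enumerate r m (List.range' q (m + 1)) ((q + (m + 1)) :: ks) (q + (m + 2)))).natWrites := by
      intro k c hc h
      rcases h with h | h
      · rw [natWrites_eliminate, Set.mem_singleton_iff] at h
        omega
      · have := natWrites_enumerate _ _ _ _ _ h
        rw [Set.mem_union, Set.mem_Icc, Set.mem_Ici] at this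
        omega
    refine (Runs.seqAll_hit (β := n * (n * V)) (C := fun _ => 50 * (m + 2) + C + 21 + 21) (J := J)
      (D := Reaches r z) (hit := fun k => ∃ i j, hit k i j) (Nat.mul_pos hn (Nat.mul_pos hn hV1))
      (List.range (m + 2)) (fun k hk s₁ hJ₁ => ?_) s ⟨hs, rfl, rfl, hinc⟩).mono ?_ ?_
    · rw [List.mem_range] at hk
      refine (Runs.forLoop_hit (e := var 0) (C := 50 * (m + 2) + C + 21) (N := n) (M := n) (β := n * V) (J := J)
        (D := Reaches r z) (hit := fun i => ∃ (h : i < n) (j : Fin n), hit k ⟨i, h⟩ j)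
        le_rfl hn (Nat.mul_pos hn hV1) ?_
        (fun s' i h => hJw s' q i hq h) (fun s' i h => h.writeNat (by omega) _ _) hJ₁
        (fun s' h => h.1) fun i s₂ hi hi₂ hJ₂ => ?_).mono le_rfl ?_
      · rw [Program.natWrites_forLoop]
        rintro (h | h)
        · exact absurd h (by simp)
        · exact hcounter k q (Or.inl rfl) h
      · refine (Runs.forLoop_hit (e := var 0) (C := 50 * (m + 2) + C) (N := n) (M := n) (β := V)
          (J := fun s' => J s' ∧ s'.nat q 0 = i) (D := Reaches r z)
          (hit := fun j => ∃ h : j < n, hit k ⟨i, hi⟩ ⟨j, h⟩) le_rfl hn hV1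
          (hcounter k (q + 1) (Or.inr rfl))
          (fun s' i h => ⟨hJw s' (q + 1) i (by omega) h.1,
            by rw [Store.writeNat_nat_of_ne _ (by omega), h.2]⟩)
          (fun s' i h => h.writeNat (by omega) _ _) ⟨hJ₂, hi₂⟩ (fun s' h => h.1.1)
          fun j s₃ hj hj₃ hJ₃ => ?_).mono le_rfl ?_
        · refine (body k hk ⟨i, hi⟩ ⟨j, hj⟩ s₃ hJ₃.1 hJ₃.2 hj₃).frame.mono le_rfl ?_
          rintro s₄ ⟨⟨h1, h2, h3⟩, hnat, -⟩
          exact ⟨⟨h1, by rw [hnat q (hcounter k q (Or.inl rfl)), hJ₃.2]⟩, h2, fun ⟨_, h⟩ => h3 h⟩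
        · rintro s₃ ⟨h1, h2, h3⟩
          exact ⟨h1.1, h2, fun ⟨_, j, h⟩ => h3 j j.2 ⟨j.2, h⟩⟩
      · rintro s₂ ⟨h1, h2, h3⟩
        exact ⟨h1, h2, fun ⟨i, j, h⟩ => h3 i i.2 ⟨i.2, j, h⟩⟩
    · apply le_of_eq
      rw [hV]
      ring
    · rintro s₁ ⟨h1, h2, h3⟩
      refine ⟨h1.2.2.2, h2, fun K hK hits => ?_⟩
      rw [← hR, ← hK₀] at hK
      obtain ⟨k, i, j, b, hb, hK⟩ := hK.exists_step (by omega)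
      have hk : k < m + 2 := hRlen ▸ (List.getElem?_eq_some_iff.mp hb).1
      exact h3 k (List.mem_range.mpr hk) ⟨i, j, b, hb, K, hK, hits⟩

/-! ## The algorithm -/

theorem readVecs_input {r n : ℕ} (A : Matrix (Fin r) (Fin n) ℝ) :
    (input A).readVecs (List.range r) n = rowList A := by
  refine List.ext_getElem ?_ fun i h _ => ?_
  · rw [Store.readVecs, List.length_map, List.length_range, rowList, List.length_ofFn]
  · have hi : i < r := by simpa [Store.readVecs] using h
    simp only [Store.readVecs, rowList, List.getElem_map, List.getElem_range, List.getElem_ofFn]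
    ext j
    simp [Store.readVec, input, hi]

theorem exists_program (m : ℕ) : ∃ (P : Program) (C : ℕ), ∀ (n : ℕ), 1 ≤ n →
    ∀ (A : Matrix (Fin (m + 1)) (Fin n) ℝ) (X : Set (Fin n → ℝ)) (f : (Fin (m + 1) → ℝ) → ℝ)
      (Ψ : Equiv.Perm (Fin n) → Equiv.Perm (Fin n))
      (ans : Finset (Fin n) → Option ((Fin n → ℝ) × ℝ)) (T₁ T₂ : ℕ),
        ComonotoneVia Ψ X → ConvexOn ℝ Set.univ f →
        (∃ x, IsOptimal (fun y => f (A *ᵥ y)) X x) →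
        SolvesFixedSupport (fun y => f (A *ᵥ y)) X ans → 1 ≤ T₁ →
          Runs { perm := Ψ, permTime := T₂, supp := ans, suppTime := T₁ } P (input A)
            (C * (n ^ (2 * m) * T₂ + n ^ (2 * (m + 1)) * T₁))
            fun s => IsOptimal (fun y => f (A *ᵥ y)) X (s.readVec (m + 1) n) := by
  obtain ⟨C, hC⟩ := runs_enumerate (m + 1) m (List.range (m + 1)) [] (m + 10) (by simp) (by omega)
    (by omega) (by
      intro a ha
      have : a < m + 1 := by simpa using ha
      omega)
  refine ⟨enumerate (m + 1) m (List.range (m + 1)) [] (m + 10), C, fun n hn A X f Ψ ans T₁ T₂ hX hf hopt hans hT₁ => ?_⟩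
  obtain ⟨K, hK, a, ha, c, hc, x, hx, hsupp⟩ := exists_candidate_isOptimal hn A hX hf hopt
  -- The threshold z is the optimal value. Initially the flag in array 5 is 0, so the incumbent
  -- invariant holds vacuously.
  refine (hC n { perm := Ψ, permTime := T₂, supp := ans, suppTime := T₁ } (f (A *ᵥ x)) (input A) hn
    hT₁ (by simp [input]) (fun h => absurd (by simp [input]) h)).mono (le_of_eq ?_) ?_
  · ring
  · rintro s ⟨hinc, -, hhit⟩
    rw [readVecs_input] at hhit
    have hreach := hhit K hK ⟨a, ha, c, hc, by
      cases ho : ans (endsSet (Ψ (lexPerm K)) a c) with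
      | none =>
        -- The oracle cannot report failure here: `x` is optimal over all of X, hence also among the
        -- vectors with its own support.
        exact absurd ⟨x, ⟨hx.1, hsupp⟩, fun y hy => hx.2 y hy.1⟩ ((hans _).2 ho)
      | some p =>
        obtain ⟨h1, h2⟩ := (hans _).1 p.1 p.2 ho
        exact ⟨p.1, p.2, ho, by rw [h2]; exact h1.2 x ⟨hx.1, hsupp⟩⟩⟩
    obtain ⟨S, hS⟩ := hinc hreach.1
    obtain ⟨h1, h2⟩ := (hans S).1 _ _ hS
    refine ⟨h1.1.1, fun y hy => (hx.2 y hy).trans ?_⟩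
    have := hreach.2
    rw [h2] at this
    exact this

end RealRAM

theorem theorem4 (r : ℕ) (hr : 1 ≤ r) :
    -- a list of candidate supports that depends only on the matrix and the permutation mapping
    (∃ C : ℕ, ∀ (n : ℕ) (A : Matrix (Fin r) (Fin n) ℝ), A.rank = r →
      ∀ Ψ : Equiv.Perm (Fin n) → Equiv.Perm (Fin n),
        ∃ L : Finset (Finset (Fin n)), L.card ≤ C * n ^ (2 * r) ∧
          ∀ (X : Set (Fin n → ℝ)) (f : (Fin r → ℝ) → ℝ),
            ComonotoneVia Ψ X → ConvexOn ℝ Set.univ f →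
            (∃ x, IsOptimal (fun y => f (A *ᵥ y)) X x) →
              ∃ S ∈ L, ∃ x, IsOptimal (fun y => f (A *ᵥ y)) X x ∧
                Function.support x = (S : Set (Fin n))) ∧
    -- one program for all instances of rank `r`, which leaves a solution in the real array `r`
    (∃ (P : RealRAM.Program) (C : ℕ), ∀ (n : ℕ) (A : Matrix (Fin r) (Fin n) ℝ), A.rank = r →
      ∀ (X : Set (Fin n → ℝ)) (f : (Fin r → ℝ) → ℝ)
        (Ψ : Equiv.Perm (Fin n) → Equiv.Perm (Fin n))
        (ans : Finset (Fin n) → Option ((Fin n → ℝ) × ℝ)) (T₁ T₂ : ℕ),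
          ComonotoneVia Ψ X → ConvexOn ℝ Set.univ f →
          (∃ x, IsOptimal (fun y => f (A *ᵥ y)) X x) →
          SolvesFixedSupport (fun y => f (A *ᵥ y)) X ans → 1 ≤ T₁ → 1 ≤ T₂ →
            ∃ (t : ℕ) (s : RealRAM.Store),
              RealRAM.Exec { perm := Ψ, permTime := T₂, supp := ans, suppTime := T₁ }
                P (RealRAM.input A) t s ∧
              t ≤ C * (n ^ (2 * r - 2) * T₂ + n ^ (2 * r) * T₁) ∧
              IsOptimal (fun y => f (A *ᵥ y)) X (s.readVec r n)) := by
  -- Full row rank gives 1 ≤ r ≤ n. For n = 0 the bound on the number of supports would be zero,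
  -- although the empty support may be needed.
  have pos : ∀ {n : ℕ} (A : Matrix (Fin r) (Fin n) ℝ), A.rank = r → 1 ≤ n := fun {n} A hA => by
    have := A.rank_le_width
    omega
  obtain ⟨m, rfl⟩ : ∃ m, r = m + 1 := ⟨r - 1, by omega⟩
  constructor
  · obtain ⟨C, hC⟩ := exists_candidate_supports m
    exact ⟨C, fun n A hA Ψ => hC n (pos A hA) A Ψ⟩
  · obtain ⟨P, C, hC⟩ := RealRAM.exists_program m
    refine ⟨P, C, fun n A hA X f Ψ ans T₁ T₂ hX hf hopt hans hT₁ _ => ?_⟩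
    obtain ⟨t, s, hrun, ht, hs⟩ := hC n (pos A hA) A X f Ψ ans T₁ T₂ hX hf hopt hans hT₁
    exact ⟨t, s, hrun, ht, hs⟩
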